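/- **Setting.** Let $D\subset\mathbb R^d$ be a domain (open and connected, non-empty), and let $$Au(x)=\tfrac12\mathrm{Tr}\big(\mathbf Q(x)\nabla^2u(x)\big)+b(x)\cdot\nabla u(x)+\int_{\mathbb R^d}\Big(u(x+y)-u(x)-\frac{y\cdot\nabla u(x)}{1+|y|^2}\Big)N(x,dy),$$ where $\mathbf Q=[q_{i,j}]$ and $b$ are bounded and Borel measurable on $D$, $\mathbf Q(x)$ is non-negative definite for each $x\in D$, and $N$ is a Lévy kernel, i.e. a kernel of $\sigma$-finite Borel measures on $\mathbb R^d\setminus\{0\}$ with $\sup_{x\in\mathbb R^d}\int\min\{1,|y|^2\}N(x,dy)<\infty$. Let $(X_t)_{t\ge0}$ be the canonical process on the space $\bar{\mathcal D}$ of càdlàg paths $[0,\infty)\to\mathbb R^d\cup\{\partial\}$ (one-point compactification; functions on $\mathbb R^d$ are extended by $0$ at $\partial$), with natural filtration $(\mathcal F_t)$. A Borel probability measure $P$ on $\bar{\mathcal D}$ solves the martingale problem for $A$ with initial law $\mu$ if $X_0$ has law $\mu$ under $P$, $P$-a.s. the path is a càdlàg path in $\mathbb R^d$, and for every $f\in C^2_b(\mathbb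 R^d)$ the process $f(X_t)-f(X_0)-\int_0^tAf(X_r)\,dr$ is (well defined and) an $(\mathcal F_t)$-martingale under $P$. Let $(P_x)_{x\in\mathbb R^d}$ be a strong Markovian solution of the martingale problem for $A$: each $P_x$ is a solution with initial law $\delta_x$; $(X_t)$ is strongly Markovian with respect to $(\mathcal F_t)$ and $(P_x)$; $x\mapsto P_x[C]$ is measurable for every Borel $C$; and for every Borel probability measure $\mu$ on $\mathbb R^d$ the measure $\int P_x(\cdot)\,\mu(dx)$ is a solution with initial law $\mu$. Let $\tau_D=\inf\{t>0: X_t\notin D\}$ and assume $P_x[\tau_D<\infty]=1$ for all $x\in D$. For Borel $f:D\to[0,\infty)$ and $\alpha\ge0$ set $$P^D_tf(x)=\mathbb E_x[f(X_t),\,t<\tau_D],\qquad R^D_\alpha f(x)=\int_0^\infty e^{-\alpha t}P^D_tf(x)\,dt\in[0,\infty],\qquad x\in D.$$ A Borel function $\psi:D\to[0,\infty)$ is called $\beta$-excessive if $P^D_t\psi(x)\le e^{\beta t}\psi(x)$ for all $t\ge0$ and $\lim_{t\to0+}P^D_t\psi(x)=\psi(x)$, for all $x\in D$. Write $B_b^+(D)$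 for the non-negative bounded Borel functions on $D$. **Theorem.** Let $m$ be a non-trivial $\sigma$-finite Borel measure on $D$ such that the resolvent of $A$ is $m$-irreducible: for every $f\in B_b^+(D)$ with $\int_Df\,dm>0$ one has $R^D_1f(x)>0$ for all $x\in D$. Then for each $\alpha\ge0$ there exist an $(\alpha+1)$-excessive function $\psi^\alpha_D:D\to(0,+\infty)$ and a $\sigma$-finite Borel measure $\nu^\alpha_D$ on $D$ with $m\ll\nu^\alpha_D$ such that $$R^D_\alpha f(x)\ge\psi^\alpha_D(x)\int_Df\,d\nu^\alpha_D,\qquad x\in D,\ f\in B_b^+(D).$$ -/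

import Mathlib

open MeasureTheory ProbabilityTheory Filter Topology
open scoped NNReal ENNReal

noncomputable section

/-- Right-continuous paths indexed by `[0, ∞)` that have left limits at every time. -/
def IsCadlag {S : Type*} [TopologicalSpace S] (ω : ℝ≥0 → S) : Prop :=
  ∀ t, ContinuousWithinAt ω (Set.Ici t) t ∧ ∃ l, Tendsto ω (𝓝[<] t) (𝓝 l)

/-- The space `ℝᵈ` with its Euclidean norm. -/
abbrev Rd (d : ℕ) : Type := EuclideanSpace ℝ (Fin d)

/-- The one-point compactification of `ℝᵈ` (the added point is the cemetery state) carries its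
Borel `σ`-algebra. -/
instance onePointMeasurableSpace (d : ℕ) : MeasurableSpace (OnePoint (Rd d)) := borel _

instance onePointBorelSpace (d : ℕ) : BorelSpace (OnePoint (Rd d)) := ⟨rfl⟩

/-- Extension of a function on `ℝᵈ` by the value `0` at the cemetery state. -/
def extendZero {d : ℕ} {M : Type*} [Zero M] (f : Rd d → M) : OnePoint (Rd d) → M
  | none => 0
  | some x => f x

/-- Càdlàg paths in the one-point compactification of `ℝᵈ`. -/
def PathSpace (d : ℕ) : Type := {ω : ℝ≥0 → OnePoint (Rd d) // IsCadlag ω}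

namespace PathSpace

variable {d : ℕ}

/-- The canonical process `X_t(ω) = ω(t)`. -/
def X (t : ℝ≥0) (ω : PathSpace d) : OnePoint (Rd d) := ω.1 t

/-- The `σ`-algebra generated by the canonical process. Since the state space is a compact
metrizable space, this is the Borel `σ`-algebra of the Skorokhod topology. -/
instance : MeasurableSpace (PathSpace d) := ⨆ t : ℝ≥0, MeasurableSpace.comap (X t) inferInstance

/-- The natural filtration `ℱ_t = σ(X_s, s ≤ t)` of the canonical process. -/
def naturalFiltration (d : ℕ) :
    Filtration ℝ≥0 (inferInstance : MeasurableSpace (PathSpace d)) where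
  seq t := ⨆ s : ℝ≥0, ⨆ _ : s ≤ t, MeasurableSpace.comap (X s) inferInstance
  mono' _ _ h := iSup_mono fun _ => iSup_mono' fun hs => ⟨hs.trans h, le_rfl⟩
  le' _ := iSup_le fun s => iSup_le fun _ =>
    le_iSup (fun s : ℝ≥0 => MeasurableSpace.comap (X (d := d) s) inferInstance) s

theorem isCadlag_shift {ω : ℝ≥0 → OnePoint (Rd d)} (hω : IsCadlag ω) (t : ℝ≥0) :
    IsCadlag fun s => ω (t + s) := by
  intro s
  have hc : Continuous fun r : ℝ≥0 => t + r := by fun_prop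
  refine ⟨(hω (t + s)).1.comp hc.continuousWithinAt fun r hr => ?_, ?_⟩
  · exact add_le_add_right (Set.mem_Ici.1 hr) t
  · obtain ⟨l, hl⟩ := (hω (t + s)).2
    refine ⟨l, hl.comp ?_⟩
    refine tendsto_nhdsWithin_of_tendsto_nhds_of_eventually_within _
      (hc.continuousAt.tendsto.mono_left nhdsWithin_le_nhds) ?_
    filter_upwards [self_mem_nhdsWithin] with r hr
    exact add_lt_add_right (Set.mem_Iio.1 hr) t

/-- The shift operator `θ_t`, `(θ_t ω)(s) = ω(t + s)`. -/
def shift (t : ℝ≥0) (ω : PathSpace d) : PathSpace d :=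
  ⟨fun s => ω.1 (t + s), isCadlag_shift ω.2 t⟩

/-- The paths that are càdlàg as paths in `ℝᵈ`, i.e. that never visit the cemetery state and whose
left limits belong to `ℝᵈ`. -/
def finitePaths (d : ℕ) : Set (PathSpace d) :=
  {ω | ∃ γ : ℝ≥0 → Rd d, IsCadlag γ ∧ ∀ t, X t ω = (γ t : OnePoint (Rd d))}

/-- The path that stays forever at the cemetery state. -/
def cemetery (d : ℕ) : PathSpace d :=
  ⟨fun _ => OnePoint.infty, fun _ => ⟨continuousWithinAt_const, _, tendsto_const_nhds⟩⟩

/-- The exit time `τ_D = inf {t > 0 : X_t ∉ D}`, with `inf ∅ = ∞`. -/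
def exitTime (D : Set (Rd d)) (ω : PathSpace d) : ℝ≥0∞ :=
  ⨅ (t : ℝ≥0) (_ : 0 < t) (_ : X t ω ∉ ((↑) : Rd d → OnePoint (Rd d)) '' D), (t : ℝ≥0∞)

end PathSpace

/-- The coefficients of an integro-differential operator: the matrix `Q`, the drift `b` and the
Lévy kernel `N`. -/
structure LevyOperator (d : ℕ) where
  Q : Rd d → Matrix (Fin d) (Fin d) ℝ
  b : Rd d → Rd d
  N : Kernel (Rd d) (Rd d)

/-- The matrix of second order partial derivatives. -/
def hessianMatrix {d : ℕ} (u : Rd d → ℝ) (x : Rd d) : Matrix (Fin d) (Fin d) ℝ :=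
  Matrix.of fun i j =>
    iteratedFDeriv ℝ 2 u x ![EuclideanSpace.single i (1 : ℝ), EuclideanSpace.single j (1 : ℝ)]

/-- Twice continuously differentiable functions, bounded together with their derivatives of order
one and two. -/
def IsCb2 {d : ℕ} (u : Rd d → ℝ) : Prop :=
  ContDiff ℝ 2 u ∧ ∃ C : ℝ, ∀ k : ℕ, k ≤ 2 → ∀ x, ‖iteratedFDeriv ℝ k u x‖ ≤ C

namespace LevyOperator

variable {d : ℕ}

/-- `A u(x) = ½ Tr(Q(x) ∇²u(x)) + b(x)·∇u(x)
  + ∫ (u(x+y) - u(x) - y·∇u(x) / (1+|y|²)) N(x,dy)`. -/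
def apply (A : LevyOperator d) (u : Rd d → ℝ) (x : Rd d) : ℝ :=
  1 / 2 * (A.Q x * hessianMatrix u x).trace + fderiv ℝ u x (A.b x)
    + ∫ y, (u (x + y) - u x - fderiv ℝ u x y / (1 + ‖y‖ ^ 2)) ∂(A.N x)

/-- The standing assumptions on the coefficients over the domain `D`: `Q` and `b` are bounded and
Borel measurable on `D`, `Q(x)` is non-negative definite for `x ∈ D`, and the Lévy kernel consists
of `σ`-finite measures on `ℝᵈ \ {0}` (i.e. without mass at `0`) for which
`sup_x ∫ min(1, |y|²) N(x,dy)` is finite. -/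
structure Admissible (A : LevyOperator d) (D : Set (Rd d)) : Prop where
  measurable_Q : ∀ i j, Measurable fun x : D => A.Q x i j
  measurable_b : ∀ i, Measurable fun x : D => A.b x i
  bounded_Q : ∃ C : ℝ, ∀ x ∈ D, ∀ i j, |A.Q x i j| ≤ C
  bounded_b : ∃ C : ℝ, ∀ x ∈ D, ∀ i, |A.b x i| ≤ C
  nonneg_Q : ∀ x ∈ D, ∀ ξ : Fin d → ℝ, 0 ≤ ∑ i, ∑ j, A.Q x i j * ξ i * ξ j
  sigmaFinite_N : ∀ x ∈ D, SigmaFinite (A.N x)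
  N_zero : ∀ x, A.N x {0} = 0
  N_bound : ⨆ x, ∫⁻ y, ENNReal.ofReal (min 1 (‖y‖ ^ 2)) ∂(A.N x) < ⊤

/-- The process `M_t[f] = f(X_t) - f(X_0) - ∫₀ᵗ A f(X_r) dr`, where functions on `ℝᵈ` vanish at the
cemetery state. -/
def martingaleTerm (A : LevyOperator d) (f : Rd d → ℝ) (t : ℝ≥0) (ω : PathSpace d) : ℝ :=
  extendZero f (PathSpace.X t ω) - extendZero f (PathSpace.X 0 ω)
    - ∫ r in (0 : ℝ)..t, extendZero (A.apply f) (PathSpace.X r.toNNReal ω)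

/-- Solutions of the martingale problem associated with `A`, with initial distribution `μ`.

The field `integrable` only expresses that the time integral in `M_t[f]` exists; it holds
automatically when the coefficients are bounded and Borel measurable on the whole space. -/
structure IsMartingaleSolution (A : LevyOperator d) (μ : Measure (Rd d))
    (P : Measure (PathSpace d)) : Prop where
  isProbabilityMeasure : IsProbabilityMeasure P
  initial : ∀ Z : Set (Rd d), MeasurableSet Z →
    P {ω | PathSpace.X 0 ω ∈ ((↑) : Rd d → OnePoint (Rd d)) '' Z} = μ Z
  integrable : ∀ f : Rd d → ℝ, IsCb2 f → ∀ᵐ ω ∂P, ∀ t : ℝ≥0,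
    IntervalIntegrable (fun r : ℝ => extendZero (A.apply f) (PathSpace.X r.toNNReal ω))
      volume 0 t
  martingale : ∀ f : Rd d → ℝ, IsCb2 f →
    Martingale (A.martingaleTerm f) (PathSpace.naturalFiltration d) P
  finite : ∀ᵐ ω ∂P, ω ∈ PathSpace.finitePaths d

end LevyOperator

variable {d : ℕ}

/-- The family `(P_x)` extended to the cemetery state by the point mass at the constant path. -/
def extendCemetery (P : Rd d → Measure (PathSpace d)) : OnePoint (Rd d) → Measure (PathSpace d)
  | none => Measure.dirac (PathSpace.cemetery d)
  | some x => P x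

/-- The strong Markov property of the canonical process with respect to its natural filtration:
for every stopping time `τ`, on `{τ < ∞}` the conditional law of `θ_τ` given `ℱ_τ` is
`P_{X_τ}`. -/
def IsStrongMarkov (P : Rd d → Measure (PathSpace d)) : Prop :=
  ∀ (x : Rd d) (τ : PathSpace d → WithTop ℝ≥0)
    (hτ : IsStoppingTime (PathSpace.naturalFiltration d) τ)
    (B : Set (PathSpace d)), MeasurableSet[hτ.measurableSpace] B →
    ∀ C : Set (PathSpace d), MeasurableSet C →
      P x {ω | ω ∈ B ∧ τ ω ≠ ⊤ ∧ PathSpace.shift ((τ ω).untopD 0) ω ∈ C}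
        = ∫⁻ ω in {ω | ω ∈ B ∧ τ ω ≠ ⊤},
            extendCemetery P (PathSpace.X ((τ ω).untopD 0) ω) C ∂(P x)

/-- Strong Markovian solutions of the martingale problem associated with `A`. -/
structure IsStrongMarkovSolution (A : LevyOperator d) (P : Rd d → Measure (PathSpace d)) :
    Prop where
  solution : ∀ x, A.IsMartingaleSolution (Measure.dirac x) (P x)
  strongMarkov : IsStrongMarkov P
  measurable : ∀ C : Set (PathSpace d), MeasurableSet C → Measurable fun x => P x C
  mixture : ∀ μ : Measure (Rd d), IsProbabilityMeasure μ →
    A.IsMartingaleSolution μ (μ.bind P)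

/-- The exit time from `D` is almost surely finite for every starting point in `D`. -/
def ExitsFinitely (P : Rd d → Measure (PathSpace d)) (D : Set (Rd d)) : Prop :=
  ∀ x ∈ D, ∀ᵐ ω ∂(P x), PathSpace.exitTime D ω < ⊤

/-- The semigroup of the process killed on leaving `D`, acting on non-negative functions:
`P^D_t f(x) = E_x[f(X_t), t < τ_D]`. -/
def killedSemigroup (P : Rd d → Measure (PathSpace d)) (D : Set (Rd d)) (t : ℝ≥0)
    (f : D → ℝ≥0) (x : D) : ℝ≥0∞ :=
  ∫⁻ ω in {ω | (t : ℝ≥0∞) < PathSpace.exitTime D ω},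
    (extendZero (Function.extend Subtype.val f 0) (PathSpace.X t ω) : ℝ≥0) ∂(P x)

/-- The resolvent `R^D_α f(x) = ∫₀^∞ e^{-αt} P^D_t f(x) dt`, possibly infinite. -/
def killedResolvent (P : Rd d → Measure (PathSpace d)) (D : Set (Rd d)) (α : ℝ)
    (f : D → ℝ≥0) (x : D) : ℝ≥0∞ :=
  ∫⁻ t in Set.Ioi (0 : ℝ),
    ENNReal.ofReal (Real.exp (-α * t)) * killedSemigroup P D t.toNNReal f x

/-- Non-negative bounded Borel functions on `D`. -/
def IsBoundedBorel {D : Set (Rd d)} (f : D → ℝ≥0) : Prop :=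
  Measurable f ∧ ∃ C : ℝ≥0, ∀ x, f x ≤ C

/-- `m`-irreducibility of the resolvent: `R^D_1 f` is strictly positive on `D` for every
`f ∈ B_b^+(D)` with `∫ f dm > 0`. -/
def IsResolventIrreducible (P : Rd d → Measure (PathSpace d)) (D : Set (Rd d)) (m : Measure D) :
    Prop :=
  ∀ f : D → ℝ≥0, IsBoundedBorel f → 0 < ∫⁻ x, f x ∂m → ∀ x, 0 < killedResolvent P D 1 f x

/-- `α`-excessive functions `D → [0, ∞)` for the killed semigroup. -/
structure IsExcessive (P : Rd d → Measure (PathSpace d)) (D : Set (Rd d)) (α : ℝ)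
    (ψ : D → ℝ≥0) : Prop where
  measurable : Measurable ψ
  le : ∀ (t : ℝ≥0) (x : D),
    killedSemigroup P D t ψ x ≤ ENNReal.ofReal (Real.exp (α * t)) * ψ x
  tendsto : ∀ x : D, Tendsto (fun t : ℝ≥0 => killedSemigroup P D t ψ x) (𝓝[>] 0) (𝓝 (ψ x : ℝ≥0∞))

/-- The minorization condition: `ν` is a `σ`-finite Borel measure on `D` and
`R^D_α f(x) ≥ ψ(x) ∫ f dν` for all `x ∈ D` and `f ∈ B_b^+(D)`. -/
structure Minorization (P : Rd d → Measure (PathSpace d)) (D : Set (Rd d)) (α : ℝ)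
    (ψ : D → ℝ≥0) (ν : Measure D) : Prop where
  sigmaFinite : SigmaFinite ν
  le : ∀ f : D → ℝ≥0, IsBoundedBorel f → ∀ x : D,
    (ψ x : ℝ≥0∞) * ∫⁻ y, f y ∂ν ≤ killedResolvent P D α f x

end

/-!
The resolvent `R_{α+1}` of the killed process is a finite kernel, and by irreducibility each of its
measures dominates `m` in the sense of absolute continuity (for a probability measure `m`, without
loss of generality). Hence it has a jointly measurable density that is positive almost everywhere
and so exceeds some `δ > 0` off a set of small product measure. Then most pairs `(x, z)` are joined
through many intermediate points, which gives sets `B`, `C` of positive measure and `c > 0` with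
`R_{α+1}² f ≥ c ∫_C f dm` on `B` (`exists_minorization_of_absolutelyContinuous`). Composing with
`R_{α+1}` on both sides,
`R_{α+1}⁴ f (x) ≥ c R_{α+1} 1_B (x) ∫_C R_{α+1} f dm`,
where `R_{α+1} 1_B` is positive everywhere and `(α+1)`-excessive, and where
`ν f = ∫_C R_{α+1} f dm` defines a finite measure with `m ≪ ν`, again by irreducibility. Finally
`R_{α+1} R_α ≤ R_α`, so `R_α` dominates the fourth iterate
(`IsSubMarkovSemigroup.exists_minorization`).

This needs measurability and the semigroup property of `P^D_t`, which are not automatic: the event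
`{t < τ_D}` asks that the path avoids the closed complement of `D`, and for a path that may jump
into `D` from a left limit on the boundary this need not be a Borel event. It is replaced by the
event that the path stays in a compact subset of `D` up to time `t` (`PathSpace.survives`), which
belongs to `ℱ_t` and composes well with shifts. The two events agree almost surely
(`survives_ae_eq_exitTime`): if `f ≥ 0` is smooth with compact support in `D`, and the times `S_n`
of leaving the sets of a compact exhaustion of `D` increase to `σ`, then `f(X_{S_n}) = 0` for large
`n`, and optional stopping for the martingale `M[f]` at `S_n` and `σ` gives
`E[f(X_σ); σ ≤ t] = lim E[∫_{S_n ∧ t}^{σ ∧ t} A f(X_r) dr] = 0`. Here `A f` is bounded on the whole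
space although the local coefficients are bounded only on `D` (`exists_abs_apply_le`).
-/

/-! ### Irreducible kernels dominate a rank-one kernel -/

theorem exists_prod_lt_of_ae_pos {α : Type*} [MeasurableSpace α] (m : Measure α)
    [IsProbabilityMeasure m] {r : α → α → ℝ≥0∞} (hr : Measurable fun p : α × α => r p.1 p.2)
    (hpos : ∀ x, ∀ᵐ y ∂m, 0 < r x y) {ε : ℝ≥0∞} (hε : 0 < ε) :
    ∃ δ : ℝ≥0∞, 0 < δ ∧ δ ≠ ∞ ∧ (m.prod m) {p | r p.1 p.2 < δ} < ε := by
  let S : ℕ → Set (α × α) := fun n => {p | r p.1 p.2 < ((n : ℝ≥0∞) + 1)⁻¹}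
  have hS : ∀ n, MeasurableSet (S n) := fun n => measurableSet_lt hr measurable_const
  have hanti : Antitone S := fun a b hab p hp => by
    refine lt_of_lt_of_le (show r p.1 p.2 < _ from hp) ?_
    gcongr
  have hlim := tendsto_measure_iInter_atTop (μ := m.prod m) (fun n => (hS n).nullMeasurableSet)
    hanti ⟨0, measure_ne_top _ _⟩
  have hzero : (m.prod m) (⋂ n, S n) = 0 := by
    rw [Measure.prod_apply (MeasurableSet.iInter hS), lintegral_eq_zero_iff']
    · refine Eventually.of_forall fun x => ?_
      refine measure_mono_null ?_ (hpos x)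
      intro y hy hy'
      have hy1 : ∀ n : ℕ, r x y < ((n : ℝ≥0∞) + 1)⁻¹ := fun n => Set.mem_iInter.1 hy n
      obtain ⟨n, hn⟩ := ENNReal.exists_inv_nat_lt (a := r x y) hy'.ne'
      refine absurd (hy1 n) (not_lt.2 (le_trans ?_ hn.le))
      gcongr
      exact le_self_add
    · exact (measurable_measure_prodMk_left (MeasurableSet.iInter hS)).aemeasurable
  rw [hzero] at hlim
  obtain ⟨n, hn⟩ := (hlim.eventually (gt_mem_nhds hε)).exists
  refine ⟨((n : ℝ≥0∞) + 1)⁻¹, by simp, by simp, hn⟩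

/-- A finite kernel whose values all dominate the probability measure `m` in the sense of absolute
continuity has a density that is positive `m`-almost everywhere, hence at least some `δ > 0` off a
set of small `m ⊗ m`-measure. For most `x` and most `z`, most intermediate points `y` then
satisfy `r x y ≥ δ` and `r y z ≥ δ`, so that the density of the iterated kernel is bounded
below on a product set. -/
theorem exists_minorization_of_absolutelyContinuous {α : Type*} [MeasurableSpace α]
    [MeasurableSpace.CountablyGenerated α] (U : Kernel α α) [IsFiniteKernel U] (m : Measure α)
    [IsProbabilityMeasure m] (hU : ∀ x, m ≪ U x) :
    ∃ (B C : Set α) (c : ℝ≥0), MeasurableSet B ∧ MeasurableSet C ∧ m B ≠ 0 ∧ m C ≠ 0 ∧ 0 < c ∧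
      ∀ x ∈ B, ∀ f : α → ℝ≥0∞, Measurable f →
        c * ∫⁻ z in C, f z ∂m ≤ ∫⁻ y, ∫⁻ z, f z ∂(U y) ∂(U x) := by
  let r : α → α → ℝ≥0∞ := Kernel.rnDeriv U (Kernel.const α m)
  have hr : Measurable fun p : α × α => r p.1 p.2 := Kernel.measurable_rnDeriv U _
  have hrx : ∀ x, Measurable (r x) := fun x => Kernel.measurable_rnDeriv_right U _ x
  have hpos : ∀ x, ∀ᵐ y ∂m, 0 < r x y := by
    intro x
    have h1 : r x =ᵐ[m] (U x).rnDeriv m := by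
      simpa using Kernel.rnDeriv_eq_rnDeriv_measure (κ := U) (η := Kernel.const α m) (a := x)
    filter_upwards [h1, Measure.rnDeriv_pos' (hU x)] with y hy hy'
    rwa [hy]
  have hle : ∀ x (f : α → ℝ≥0∞), Measurable f → ∫⁻ y, r x y * f y ∂m ≤ ∫⁻ y, f y ∂(U x) := by
    intro x f hf
    have h0 := lintegral_withDensity_eq_lintegral_mul m (hrx x) hf
    simp only [Pi.mul_apply] at h0
    rw [← h0]
    refine lintegral_mono' ?_ le_rfl
    have h := Kernel.withDensity_rnDeriv_le U (Kernel.const α m) x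
    rwa [Kernel.withDensity_apply _ (Kernel.measurable_rnDeriv _ _), Kernel.const_apply] at h
  obtain ⟨δ, hδ0, hδt, hδ⟩ := exists_prod_lt_of_ae_pos m hr hpos
    (ε := (16 : ℝ≥0∞)⁻¹) (by simp)
  let S : Set (α × α) := {p | r p.1 p.2 < δ}
  have hS : MeasurableSet S := measurableSet_lt hr measurable_const
  let a : α → ℝ≥0∞ := fun x => m {y | r x y < δ}
  let b : α → ℝ≥0∞ := fun z => m {y | r y z < δ}
  have ha : Measurable a := measurable_measure_prodMk_left hS
  have hb : Measurable b := measurable_measure_prodMk_right hS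
  -- Both `∫ a` and `∫ b` are the product measure of `{r < δ}`, so Markov's inequality applies.
  have key : ∀ g : α → ℝ≥0∞, Measurable g → ∫⁻ x, g x ∂m < 16⁻¹ → m {x | g x < 4⁻¹} ≠ 0 := by
    intro g hg hgi h0
    have h1 : (4 : ℝ≥0∞)⁻¹ * m {x | 4⁻¹ ≤ g x} ≤ ∫⁻ x, g x ∂m :=
      mul_meas_ge_le_lintegral hg _
    have h2 : m {x | 4⁻¹ ≤ g x} = 1 := by
      have := prob_compl_eq_one_iff (μ := m) (measurableSet_lt hg (measurable_const (a := 4⁻¹)))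
      rw [← this.2 h0]
      congr 1
      ext x
      simp
    rw [h2, mul_one] at h1
    have h3 := h1.trans_lt hgi
    rw [ENNReal.inv_lt_inv] at h3
    norm_num at h3
  have hB : m {x | a x < 4⁻¹} ≠ 0 := key a ha ((Measure.prod_apply hS).symm.trans_lt hδ)
  have hC : m {z | b z < 4⁻¹} ≠ 0 := key b hb ((Measure.prod_apply_symm hS).symm.trans_lt hδ)
  refine ⟨{x | a x < 4⁻¹}, {z | b z < 4⁻¹}, (δ * δ * 2⁻¹).toNNReal,
    measurableSet_lt ha measurable_const, measurableSet_lt hb measurable_const, hB, hC, ?_, ?_⟩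
  · have : δ * δ * 2⁻¹ ≠ ∞ := by finiteness
    exact ENNReal.toNNReal_pos (by simp [hδ0.ne']) this
  intro x hx f hf
  rw [ENNReal.coe_toNNReal (by finiteness)]
  have hmid : ∀ z, b z < 4⁻¹ → δ * δ * 2⁻¹ ≤ ∫⁻ y, r x y * r y z ∂m := by
    intro z hz
    let E : Set α := {y | r x y < δ} ∪ {y | r y z < δ}
    have hE : MeasurableSet E :=
      (measurableSet_lt (hrx x) measurable_const).union
        (measurableSet_lt (hr.comp measurable_prodMk_right) measurable_const)
    have h1 : m E ≤ 2⁻¹ := by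
      refine (measure_union_le _ _).trans ((add_le_add hx.le hz.le).trans ?_)
      rw [← two_mul, show (4 : ℝ≥0∞) = 2 * 2 by norm_num,
        ENNReal.mul_inv (by simp) (by simp), ← mul_assoc,
        ENNReal.mul_inv_cancel (by simp) (by simp), one_mul]
    have h2 : (2 : ℝ≥0∞)⁻¹ ≤ m Eᶜ := by
      rw [prob_compl_eq_one_sub hE]
      refine ENNReal.le_sub_of_add_le_left (by finiteness) ((add_le_add h1 le_rfl).trans ?_)
      rw [ENNReal.inv_two_add_inv_two]
    calc δ * δ * 2⁻¹ ≤ δ * δ * m Eᶜ := by gcongr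
      _ = ∫⁻ _ in Eᶜ, δ * δ ∂m := by simp
      _ ≤ ∫⁻ y in Eᶜ, r x y * r y z ∂m := by
        refine setLIntegral_mono' hE.compl fun y hy => ?_
        have hy1 : ¬ r x y < δ ∧ ¬ r y z < δ := not_or.1 hy
        exact mul_le_mul' (not_lt.1 hy1.1) (not_lt.1 hy1.2)
      _ ≤ ∫⁻ y, r x y * r y z ∂m := setLIntegral_le_lintegral _ _
  have hr' : Measurable fun p : α × α => r p.2 p.1 := hr.comp measurable_swap
  calc δ * δ * 2⁻¹ * ∫⁻ z in {z | b z < 4⁻¹}, f z ∂m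
      = ∫⁻ z in {z | b z < 4⁻¹}, δ * δ * 2⁻¹ * f z ∂m := by
        rw [lintegral_const_mul _ hf]
    _ ≤ ∫⁻ z in {z | b z < 4⁻¹}, (∫⁻ y, r x y * r y z ∂m) * f z ∂m := by
        refine setLIntegral_mono' (measurableSet_lt hb measurable_const) fun z hz => ?_
        gcongr
        exact hmid z hz
    _ ≤ ∫⁻ z, (∫⁻ y, r x y * r y z ∂m) * f z ∂m := setLIntegral_le_lintegral _ _
    _ = ∫⁻ z, ∫⁻ y, r x y * (r y z * f z) ∂m ∂m := by
        refine lintegral_congr fun z => ?_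
        have hm : Measurable fun y => r x y * r y z :=
          (hrx x).mul (hr.comp measurable_prodMk_right)
        rw [← lintegral_mul_const _ hm]
        simp only [mul_assoc]
    _ = ∫⁻ y, ∫⁻ z, r x y * (r y z * f z) ∂m ∂m := by
        refine lintegral_lintegral_swap (Measurable.aemeasurable ?_)
        exact ((hrx x).comp measurable_snd).mul (hr'.mul (hf.comp measurable_fst))
    _ = ∫⁻ y, r x y * ∫⁻ z, r y z * f z ∂m ∂m := by
        refine lintegral_congr fun y => ?_
        exact lintegral_const_mul _ ((hrx y).mul hf)
    _ ≤ ∫⁻ y, r x y * ∫⁻ z, f z ∂(U y) ∂m := by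
        exact lintegral_mono fun y => mul_le_mul' le_rfl (hle y f hf)
    _ ≤ ∫⁻ y, ∫⁻ z, f z ∂(U y) ∂(U x) := hle x _ hf.lintegral_kernel

/-! ### Optional stopping for bounded right-continuous martingales -/

/-- The least point of the grid `2⁻ᵏ ℕ` that is strictly greater than `t`. -/
noncomputable def gridAbove (k : ℕ) (t : ℝ≥0) : ℝ≥0 := (⌊t * 2 ^ k⌋₊ + 1) / 2 ^ k

theorem lt_gridAbove (k : ℕ) (t : ℝ≥0) : t < gridAbove k t := by
  rw [gridAbove, lt_div_iff₀ (by positivity)]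
  exact Nat.lt_floor_add_one _

theorem gridAbove_le (k : ℕ) (t : ℝ≥0) : gridAbove k t ≤ t + (2 ^ k)⁻¹ := by
  rw [gridAbove, add_div, one_div]
  gcongr
  rw [div_le_iff₀ (by positivity)]
  exact Nat.floor_le zero_le

theorem gridAbove_le_iff (k : ℕ) (t s : ℝ≥0) :
    gridAbove k t ≤ s ↔ t < (⌊s * 2 ^ k⌋₊ : ℝ≥0) / 2 ^ k := by
  rw [gridAbove, div_le_iff₀ (by positivity), lt_div_iff₀ (by positivity),
    ← Nat.floor_lt zero_le, ← Nat.succ_le_iff, Nat.le_floor_iff zero_le]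
  push_cast
  rfl

theorem countable_range_gridAbove (k : ℕ) : (Set.range (gridAbove k)).Countable := by
  refine (Set.countable_range fun n : ℕ => ((n : ℝ≥0) + 1) / 2 ^ k).mono ?_
  rintro _ ⟨t, rfl⟩
  exact ⟨⌊t * 2 ^ k⌋₊, rfl⟩

theorem tendsto_gridAbove (t : ℝ≥0) : Tendsto (fun k => gridAbove k t) atTop (𝓝[≥] t) := by
  refine tendsto_nhdsWithin_iff.2 ⟨?_, Eventually.of_forall fun k => (lt_gridAbove k t).le⟩
  have h : Tendsto (fun k : ℕ => t + ((2 : ℝ≥0) ^ k)⁻¹) atTop (𝓝 t) := by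
    have := tendsto_pow_atTop_nhds_zero_of_lt_one (r := (2 : ℝ≥0)⁻¹) zero_le
      (inv_lt_one_of_one_lt₀ (by norm_num))
    simpa [inv_pow] using Tendsto.const_add t this
  exact tendsto_of_tendsto_of_tendsto_of_le_of_le tendsto_const_nhds h
    (fun k => (lt_gridAbove k t).le) fun k => gridAbove_le k t

/-- Optional stopping for a bounded martingale with right-continuous paths at a bounded optional
time, by approximation from the right with stopping times taking countably many values. -/
theorem integral_martingale_optional {Ω : Type*} {mΩ : MeasurableSpace Ω} {μ : Measure Ω}
    [IsProbabilityMeasure μ] {ℱ : Filtration ℝ≥0 mΩ} {M : ℝ≥0 → Ω → ℝ} (hM : Martingale M ℱ μ)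
    (hrc : ∀ᵐ ω ∂μ, ∀ t, ContinuousWithinAt (fun s => M s ω) (Set.Ici t) t)
    {N : ℝ≥0} {C : ℝ} (hC : ∀ t ≤ N + 1, ∀ ω, |M t ω| ≤ C) {T : Ω → ℝ≥0} (hTN : ∀ ω, T ω ≤ N)
    (hT : ∀ s : ℝ≥0, MeasurableSet[ℱ s] {ω | T ω < s}) :
    Integrable (fun ω => M (T ω) ω) μ ∧ ∫ ω, M (T ω) ω ∂μ = ∫ ω, M 0 ω ∂μ := by
  let τ : ℕ → Ω → WithTop ℝ≥0 := fun k ω => (gridAbove k (T ω) : ℝ≥0)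
  have hτ : ∀ k, IsStoppingTime ℱ (τ k) := by
    intro k s
    have : {ω | τ k ω ≤ s} = {ω | T ω < (⌊s * 2 ^ k⌋₊ : ℝ≥0) / 2 ^ k} := by
      ext ω
      simp only [τ, Set.mem_ofPred_eq, WithTop.coe_le_coe, gridAbove_le_iff]
    rw [this]
    refine ℱ.mono ?_ _ (hT _)
    rw [div_le_iff₀ (by positivity)]
    exact Nat.floor_le zero_le
  have hgN : ∀ k ω, gridAbove k (T ω) ≤ N + 1 := fun k ω =>
    (gridAbove_le k _).trans
      (add_le_add (hTN ω) (inv_le_one_of_one_le₀ (one_le_pow₀ (by norm_num))))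
  have hτN : ∀ k ω, τ k ω ≤ (N + 1 : ℝ≥0) := fun k ω => WithTop.coe_le_coe.2 (hgN k ω)
  have hopt : ∀ k, (fun ω => M (gridAbove k (T ω)) ω) =ᵐ[μ]
      μ[M (N + 1) | (hτ k).measurableSpace] := by
    intro k
    refine hM.stoppedValue_ae_eq_condExp_of_le_const_of_countable_range (hτ k) (hτN k) ?_
    refine ((countable_range_gridAbove k).image (fun t : ℝ≥0 => (t : WithTop ℝ≥0))).mono ?_
    rintro _ ⟨ω, rfl⟩
    exact ⟨_, ⟨T ω, rfl⟩, rfl⟩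
  have hint : ∀ k, Integrable (fun ω => M (gridAbove k (T ω)) ω) μ := fun k =>
    (integrable_congr (hopt k)).2 integrable_condExp
  have hval : ∀ k, ∫ ω, M (gridAbove k (T ω)) ω ∂μ = ∫ ω, M 0 ω ∂μ := by
    intro k
    rw [integral_congr_ae (hopt k), integral_condExp ((hτ k).measurableSpace_le),
      ← setIntegral_univ, ← setIntegral_univ (f := M 0)]
    exact (hM.setIntegral_eq zero_le MeasurableSet.univ).symm
  have hlim : ∀ᵐ ω ∂μ, Tendsto (fun k => M (gridAbove k (T ω)) ω) atTop (𝓝 (M (T ω) ω)) := by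
    filter_upwards [hrc] with ω hω
    exact (hω (T ω)).tendsto.comp (tendsto_gridAbove (T ω))
  have hbound : ∀ k, ∀ᵐ ω ∂μ, ‖M (gridAbove k (T ω)) ω‖ ≤ C := fun k =>
    Eventually.of_forall fun ω => hC _ (hgN k ω) ω
  refine ⟨⟨aestronglyMeasurable_of_tendsto_ae atTop (fun k => (hint k).1) hlim, ?_⟩, ?_⟩
  · refine HasFiniteIntegral.of_bounded (C := C) (Eventually.of_forall fun ω => ?_)
    exact hC _ ((hTN ω).trans le_self_add) ω
  · have := tendsto_integral_of_dominated_convergence (fun _ => C) (fun k => (hint k).1)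
      (integrable_const C) hbound hlim
    simp only [hval] at this
    exact tendsto_nhds_unique this tendsto_const_nhds

/-! ### The operator maps test functions supported in `D` to bounded functions -/

section Generator

variable {d : ℕ}

theorem isCb2_of_hasCompactSupport {u : Rd d → ℝ} (hu : ContDiff ℝ 2 u)
    (hc : HasCompactSupport u) : IsCb2 u := by
  refine ⟨hu, ?_⟩
  have h : ∀ k : ℕ, k ≤ 2 → ∃ C, ∀ x, ‖iteratedFDeriv ℝ k u x‖ ≤ C := fun k hk =>
    (hu.continuous_iteratedFDeriv (by exact_mod_cast hk)).bounded_above_of_compact_support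
      (hc.iteratedFDeriv k)
  choose! C hC using h
  refine ⟨max (C 0) (max (C 1) (C 2)), fun k hk x => (hC k hk x).trans ?_⟩
  interval_cases k <;> simp

theorem norm_sub_sub_fderiv_le {u : Rd d → ℝ} (hu : ContDiff ℝ 2 u) {C : ℝ}
    (hC : ∀ x, ‖iteratedFDeriv ℝ 2 u x‖ ≤ C) (x y : Rd d) :
    ‖u (x + y) - u x - fderiv ℝ u x y‖ ≤ C * ‖y‖ ^ 2 := by
  have hd : Differentiable ℝ u := hu.differentiable (by norm_num)
  have hd2 : Differentiable ℝ (fderiv ℝ u) :=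
    (hu.fderiv_right (m := 1) (by norm_num)).differentiable (by norm_num)
  have hC2 : ∀ z, ‖fderiv ℝ (fderiv ℝ u) z‖ ≤ C := fun z => by
    rw [← norm_iteratedFDeriv_one, norm_iteratedFDeriv_fderiv]
    exact hC z
  have hC0 : 0 ≤ C := (norm_nonneg _).trans (hC x)
  have hball : ∀ z ∈ Metric.closedBall x ‖y‖, ‖fderiv ℝ u z - fderiv ℝ u x‖ ≤ C * ‖y‖ := by
    intro z hz
    refine (Convex.norm_image_sub_le_of_norm_fderiv_le (fun w _ => hd2 w) (fun w _ => hC2 w)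
      convex_univ (Set.mem_univ x) (Set.mem_univ z)).trans ?_
    gcongr
    simpa [dist_eq_norm] using hz
  have := Convex.norm_image_sub_le_of_norm_fderiv_le' (f := u) (φ := fderiv ℝ u x)
    (s := Metric.closedBall x ‖y‖) (fun w _ => hd w) hball (convex_closedBall x _)
    (Metric.mem_closedBall_self (norm_nonneg y)) (y := x + y) (by simp)
  simpa [pow_two, mul_assoc] using this

theorem norm_jump_integrand_le {u : Rd d → ℝ} (hu : ContDiff ℝ 2 u) {C : ℝ}
    (hC : ∀ k : ℕ, k ≤ 2 → ∀ x, ‖iteratedFDeriv ℝ k u x‖ ≤ C) (x y : Rd d) :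
    ‖u (x + y) - u x - fderiv ℝ u x y / (1 + ‖y‖ ^ 2)‖ ≤ 3 * C * min 1 (‖y‖ ^ 2) := by
  have hC0 : 0 ≤ C := (norm_nonneg _).trans (hC 0 (by norm_num) x)
  have hu0 : ∀ z, ‖u z‖ ≤ C := fun z => by
    simpa only [norm_iteratedFDeriv_zero] using hC 0 (by norm_num) z
  have hu1 : ‖fderiv ℝ u x y‖ ≤ C * ‖y‖ := by
    refine (ContinuousLinearMap.le_opNorm _ _).trans ?_
    gcongr
    simpa only [norm_iteratedFDeriv_one] using hC 1 (by norm_num) x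
  have hu2 := norm_sub_sub_fderiv_le hu (hC 2 le_rfl) x y
  have hy := norm_nonneg y
  have h1 : 0 < 1 + ‖y‖ ^ 2 := by positivity
  rcases le_total (‖y‖ ^ 2) 1 with h | h
  · rw [min_eq_right h]
    have hy1 : ‖y‖ ≤ 1 := by nlinarith
    have e : u (x + y) - u x - fderiv ℝ u x y / (1 + ‖y‖ ^ 2)
        = (u (x + y) - u x - fderiv ℝ u x y) + fderiv ℝ u x y * (‖y‖ ^ 2 / (1 + ‖y‖ ^ 2)) := by
      field_simp
      ring
    rw [e]
    refine (norm_add_le _ _).trans ?_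
    rw [norm_mul, Real.norm_of_nonneg (by positivity : (0 : ℝ) ≤ ‖y‖ ^ 2 / (1 + ‖y‖ ^ 2))]
    have h2 : ‖y‖ ^ 2 / (1 + ‖y‖ ^ 2) ≤ ‖y‖ ^ 2 :=
      div_le_self (by positivity) (by nlinarith)
    have h3 : ‖fderiv ℝ u x y‖ ≤ C := hu1.trans (by nlinarith)
    have h4 : ‖fderiv ℝ u x y‖ * (‖y‖ ^ 2 / (1 + ‖y‖ ^ 2)) ≤ C * ‖y‖ ^ 2 := by gcongr
    nlinarith [mul_nonneg hC0 (sq_nonneg ‖y‖)]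
  · rw [min_eq_left h, mul_one]
    have h2 : ‖fderiv ℝ u x y / (1 + ‖y‖ ^ 2)‖ ≤ C := by
      rw [norm_div, Real.norm_of_nonneg h1.le, div_le_iff₀ h1]
      refine hu1.trans ?_
      gcongr
      nlinarith [sq_nonneg (‖y‖ - 1)]
    calc _ ≤ ‖u (x + y) - u x‖ + ‖fderiv ℝ u x y / (1 + ‖y‖ ^ 2)‖ := norm_sub_le _ _
      _ ≤ (‖u (x + y)‖ + ‖u x‖) + C := by gcongr; exact norm_sub_le _ _
      _ ≤ 3 * C := by linarith [hu0 (x + y), hu0 x]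

/-- The local part of `A f` vanishes off the support of `f`, where no bound on the coefficients
is available; the jump part is bounded everywhere by Taylor's formula. -/
theorem exists_abs_apply_le {A : LevyOperator d} {D : Set (Rd d)} (hA : A.Admissible D)
    {u : Rd d → ℝ} (hu : IsCb2 u) (hsupp : tsupport u ⊆ D) : ∃ C, ∀ x, |A.apply u x| ≤ C := by
  obtain ⟨hu, C, hC⟩ := hu
  obtain ⟨CQ, hQ⟩ := hA.bounded_Q
  obtain ⟨Cb, hb⟩ := hA.bounded_b
  have hC0 : 0 ≤ C := (norm_nonneg _).trans (hC 0 (by norm_num) 0)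
  have hjump : ∀ x, |∫ y, (u (x + y) - u x - fderiv ℝ u x y / (1 + ‖y‖ ^ 2)) ∂(A.N x)|
      ≤ 3 * C * (⨆ x, ∫⁻ y, ENNReal.ofReal (min 1 (‖y‖ ^ 2)) ∂(A.N x)).toReal := by
    intro x
    rw [← Real.norm_eq_abs]
    refine (norm_integral_le_lintegral_norm _).trans ?_
    rw [← ENNReal.toReal_ofReal (by positivity : (0 : ℝ) ≤ 3 * C), ← ENNReal.toReal_mul]
    refine ENNReal.toReal_mono (ENNReal.mul_ne_top ENNReal.ofReal_ne_top hA.N_bound.ne) ?_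
    calc _ ≤ ∫⁻ y, ENNReal.ofReal (3 * C) * ENNReal.ofReal (min 1 (‖y‖ ^ 2)) ∂(A.N x) := by
          refine lintegral_mono fun y => ?_
          rw [← ENNReal.ofReal_mul (by positivity)]
          exact ENNReal.ofReal_le_ofReal (norm_jump_integrand_le hu hC x y)
      _ = ENNReal.ofReal (3 * C) * ∫⁻ y, ENNReal.ofReal (min 1 (‖y‖ ^ 2)) ∂(A.N x) :=
          lintegral_const_mul' _ _ ENNReal.ofReal_ne_top
      _ ≤ _ := by
          gcongr
          exact le_iSup (fun x => ∫⁻ y, ENNReal.ofReal (min 1 (‖y‖ ^ 2)) ∂(A.N x)) x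
  have hlocal : ∃ L, ∀ x,
      |1 / 2 * (A.Q x * hessianMatrix u x).trace + fderiv ℝ u x (A.b x)| ≤ L := by
    refine ⟨max 0 (1 / 2 * (∑ _i : Fin d, ∑ _j : Fin d, CQ * C) + C * √(∑ _i : Fin d, Cb ^ 2)),
      fun x => ?_⟩
    by_cases hx : x ∈ tsupport u
    · refine le_max_of_le_right ?_
      have hxD := hsupp hx
      refine (abs_add_le _ _).trans (add_le_add ?_ ?_)
      · rw [abs_mul, abs_of_pos (by norm_num : (0 : ℝ) < 1 / 2)]
        gcongr
        simp only [Matrix.trace, Matrix.diag_apply, Matrix.mul_apply]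
        refine (Finset.abs_sum_le_sum_abs _ _).trans (Finset.sum_le_sum fun i _ => ?_)
        refine (Finset.abs_sum_le_sum_abs _ _).trans (Finset.sum_le_sum fun j _ => ?_)
        rw [abs_mul]
        refine mul_le_mul (hQ x hxD i j) ?_ (abs_nonneg _) ((abs_nonneg _).trans (hQ x hxD i j))
        rw [hessianMatrix, Matrix.of_apply, ← Real.norm_eq_abs]
        refine (ContinuousMultilinearMap.le_opNorm _ _).trans ?_
        simpa using hC 2 le_rfl x
      · rw [← Real.norm_eq_abs]
        refine (ContinuousLinearMap.le_opNorm _ _).trans ?_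
        refine mul_le_mul ?_ ?_ (norm_nonneg _) hC0
        · simpa only [norm_iteratedFDeriv_one] using hC 1 (by norm_num) x
        · rw [EuclideanSpace.norm_eq]
          refine Real.sqrt_le_sqrt (Finset.sum_le_sum fun i _ => ?_)
          rw [Real.norm_eq_abs]
          exact pow_le_pow_left₀ (abs_nonneg _) (hb x hxD i) 2
    · have h1 : fderiv ℝ u x = 0 := by
        by_contra h
        exact hx (support_fderiv_subset ℝ h)
      have h2 : iteratedFDeriv ℝ 2 u x = 0 := by
        by_contra h
        exact hx (support_iteratedFDeriv_subset 2 h)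
      have h3 : hessianMatrix u x = 0 := by
        ext i j
        simp [hessianMatrix, h2]
      simp [h1, h3]
  obtain ⟨L, hL⟩ := hlocal
  exact ⟨_, fun x => (abs_add_le _ _).trans (add_le_add (hL x) (hjump x))⟩

end Generator

/-! ### Leaving compact sets and leaving the domain -/

open TopologicalSpace in
theorem exists_denseSeq_between {a b : ℝ≥0} (h : a < b) :
    ∃ n, a < denseSeq ℝ≥0 n ∧ denseSeq ℝ≥0 n < b := by
  obtain ⟨_, ⟨n, rfl⟩, h1, h2⟩ := (denseRange_denseSeq ℝ≥0).exists_between h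
  exact ⟨n, h1, h2⟩

/-- An exhaustion of `D` by compact sets, each contained in the interior of the next one. -/
structure IsExhaustion {d : ℕ} (K : ℕ → Set (Rd d)) (D : Set (Rd d)) : Prop where
  isCompact : ∀ n, IsCompact (K n)
  subset_interior : ∀ n, K n ⊆ interior (K (n + 1))
  iUnion_eq : ⋃ n, K n = D

theorem exists_isExhaustion {d : ℕ} {D : Set (Rd d)} (hD : IsOpen D) :
    ∃ K, IsExhaustion K D := by
  have : LocallyCompactSpace D := hD.locallyCompactSpace
  let K : CompactExhaustion D := default
  refine ⟨fun n => (↑) '' K n, fun n => (K.isCompact n).image continuous_subtype_val,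
    fun n => ?_, ?_⟩
  · exact (Set.image_mono (K.subset_interior_succ n)).trans
      (hD.isOpenMap_subtype_val.image_interior_subset _)
  · rw [← Set.image_iUnion, K.iUnion_eq, Set.image_univ, Subtype.range_coe]

namespace IsExhaustion

variable {d : ℕ} {K : ℕ → Set (Rd d)} {D : Set (Rd d)}

theorem monotone (hK : IsExhaustion K D) : Monotone K :=
  monotone_nat_of_le_succ fun n => (hK.subset_interior n).trans interior_subset

theorem subset (hK : IsExhaustion K D) (n : ℕ) : K n ⊆ D :=
  hK.iUnion_eq ▸ Set.subset_iUnion K n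

theorem iUnion_interior (hK : IsExhaustion K D) : ⋃ n, interior (K n) = D := by
  refine Set.Subset.antisymm (Set.iUnion_subset fun n => interior_subset.trans (hK.subset n)) ?_
  rw [← hK.iUnion_eq]
  exact Set.iUnion_subset fun n => (hK.subset_interior n).trans
    (Set.subset_iUnion (fun n => interior (K n)) (n + 1))

theorem exists_superset (hK : IsExhaustion K D) {L : Set (Rd d)} (hL : IsCompact L)
    (hLD : L ⊆ D) : ∃ n, L ⊆ K n := by
  rw [← hK.iUnion_interior] at hLD
  obtain ⟨n, hn⟩ := hL.elim_directed_cover _ (fun n => isOpen_interior) hLD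
    (directed_of_isDirected_le fun a b h => interior_mono (hK.monotone h))
  exact ⟨n, hn.trans interior_subset⟩

end IsExhaustion

namespace PathSpace

open TopologicalSpace

variable {d : ℕ}

theorem measurable_X (t : ℝ≥0) : Measurable (X (d := d) t) :=
  Measurable.of_comap_le (le_iSup (fun s => MeasurableSpace.comap (X (d := d) s) inferInstance) t)

theorem measurableSet_preimage_X {s t : ℝ≥0} (h : s ≤ t) {Z : Set (OnePoint (Rd d))}
    (hZ : MeasurableSet Z) : MeasurableSet[naturalFiltration d t] (X s ⁻¹' Z) :=
  le_iSup₂ (f := fun (s : ℝ≥0) (_ : s ≤ t) => MeasurableSpace.comap (X (d := d) s) inferInstance)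
    s h _ ⟨Z, hZ, rfl⟩

theorem continuousWithinAt_X (ω : PathSpace d) (t : ℝ≥0) :
    ContinuousWithinAt (fun s => X s ω) (Set.Ici t) t := (ω.2 t).1

/-- A path that lies in an open set at time `t` stays there for a while. -/
theorem exists_forall_X_mem {ω : PathSpace d} {t : ℝ≥0} {O : Set (OnePoint (Rd d))}
    (hO : IsOpen O) (h : X t ω ∈ O) : ∃ r, t < r ∧ ∀ s, t ≤ s → s < r → X s ω ∈ O := by
  obtain ⟨r, hr, hs⟩ := mem_nhdsGE_iff_exists_Ico_subset.1
    ((continuousWithinAt_X ω t).preimage_mem_nhdsWithin (hO.mem_nhds h))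
  exact ⟨r, hr, fun s h1 h2 => hs ⟨h1, h2⟩⟩

theorem isClosed_image_coe {K : Set (Rd d)} (hK : IsCompact K) :
    IsClosed (((↑) : Rd d → OnePoint (Rd d)) '' K) :=
  OnePoint.isClosed_image_coe.2 ⟨hK.isClosed, hK⟩

/-- The infimum of the times of a fixed countable dense set at which the path is outside `K`. For
compact `K` it is the first time at which the right-continuous path leaves `K`. -/
noncomputable def leaveTime (K : Set (Rd d)) (ω : PathSpace d) : ℝ≥0∞ :=
  ⨅ (n : ℕ) (_ : X (denseSeq ℝ≥0 n) ω ∉ ((↑) : Rd d → OnePoint (Rd d)) '' K),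
    (denseSeq ℝ≥0 n : ℝ≥0∞)

theorem leaveTime_lt_iff {K : Set (Rd d)} {ω : PathSpace d} {s : ℝ≥0∞} :
    leaveTime K ω < s ↔ ∃ n, X (denseSeq ℝ≥0 n) ω ∉ ((↑) : Rd d → OnePoint (Rd d)) '' K ∧
      (denseSeq ℝ≥0 n : ℝ≥0∞) < s := by
  simp only [leaveTime, iInf_lt_iff, exists_prop]

theorem leaveTime_mono {K L : Set (Rd d)} (h : K ⊆ L) (ω : PathSpace d) :
    leaveTime K ω ≤ leaveTime L ω :=
  iInf_mono fun _ => iInf_mono' fun hn => ⟨fun hn' => hn (Set.image_mono h hn'), le_rfl⟩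

theorem leaveTime_le {K : Set (Rd d)} (hK : IsCompact K) {ω : PathSpace d} {s : ℝ≥0}
    (hs : X s ω ∉ ((↑) : Rd d → OnePoint (Rd d)) '' K) : leaveTime K ω ≤ s := by
  refine le_of_forall_gt fun r hr => ?_
  obtain ⟨r', hr1, hr2⟩ := ENNReal.lt_iff_exists_nnreal_btwn.1 hr
  obtain ⟨u, hu, h⟩ := exists_forall_X_mem (isClosed_image_coe hK).isOpen_compl hs
  obtain ⟨n, hn1, hn2⟩ := exists_denseSeq_between (lt_min hu (ENNReal.coe_lt_coe.1 hr1))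
  exact leaveTime_lt_iff.2 ⟨n, h _ hn1.le (hn2.trans_le (min_le_left _ _)),
    (ENNReal.coe_lt_coe.2 (hn2.trans_le (min_le_right _ _))).trans hr2⟩

theorem X_leaveTime_notMem {K : Set (Rd d)} (hK : IsCompact K) {ω : PathSpace d} {s : ℝ≥0}
    (hs : leaveTime K ω = s) : X s ω ∉ ((↑) : Rd d → OnePoint (Rd d)) '' interior K := by
  intro h
  obtain ⟨r, hr, hX⟩ := exists_forall_X_mem (OnePoint.isOpen_image_coe.2 isOpen_interior) h
  have : leaveTime K ω < r := hs ▸ ENNReal.coe_lt_coe.2 hr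
  obtain ⟨n, hn, hnr⟩ := leaveTime_lt_iff.1 this
  refine hn (Set.image_mono interior_subset (hX _ ?_ (ENNReal.coe_lt_coe.1 hnr)))
  by_contra! hlt
  have := leaveTime_le hK hn
  rw [hs, ENNReal.coe_le_coe] at this
  exact absurd this (not_le.2 hlt)

theorem measurableSet_leaveTime_lt {K : Set (Rd d)} (hK : IsCompact K) (s : ℝ≥0) :
    MeasurableSet[naturalFiltration d s] {ω | leaveTime K ω < s} := by
  have : {ω : PathSpace d | leaveTime K ω < s} = ⋃ (n : ℕ) (_ : denseSeq ℝ≥0 n < s),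
      X (denseSeq ℝ≥0 n) ⁻¹' (((↑) : Rd d → OnePoint (Rd d)) '' K)ᶜ := by
    ext ω
    simp only [Set.mem_ofPred_eq, leaveTime_lt_iff, Set.mem_iUnion, exists_prop,
      ENNReal.coe_lt_coe, Set.mem_preimage, Set.mem_compl_iff]
    exact exists_congr fun n => and_comm
  rw [this]
  exact MeasurableSet.iUnion fun n => MeasurableSet.iUnion fun hn =>
    measurableSet_preimage_X hn.le (isClosed_image_coe hK).measurableSet.compl

/-- The first time at which the path leaves all sets of the sequence `K`. If `K` exhausts `D`, this
is the first time at which the path, or its left limit, is outside `D`. -/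
noncomputable def limitLeaveTime (K : ℕ → Set (Rd d)) (ω : PathSpace d) : ℝ≥0∞ :=
  ⨆ n, leaveTime (K n) ω

theorem measurableSet_limitLeaveTime_lt {K : ℕ → Set (Rd d)} (hK : ∀ n, IsCompact (K n))
    (s : ℝ≥0) : MeasurableSet[naturalFiltration d s] {ω | limitLeaveTime K ω < s} := by
  have : {ω : PathSpace d | limitLeaveTime K ω < s} = ⋃ (k : ℕ) (_ : denseSeq ℝ≥0 k < s),
      ⋂ n, {ω | leaveTime (K n) ω < denseSeq ℝ≥0 k} := by
    ext ω
    simp only [Set.mem_ofPred_eq, Set.mem_iUnion, exists_prop, Set.mem_iInter]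
    constructor
    · intro h
      obtain ⟨r, hr1, hr2⟩ := ENNReal.lt_iff_exists_nnreal_btwn.1 h
      obtain ⟨k, hk1, hk2⟩ := exists_denseSeq_between (ENNReal.coe_lt_coe.1 hr2)
      exact ⟨k, hk2, fun n => (le_iSup (fun n => leaveTime (K n) ω) n).trans_lt
        (hr1.trans (ENNReal.coe_lt_coe.2 hk1))⟩
    · rintro ⟨k, hk, h⟩
      exact (iSup_le fun n => (h n).le).trans_lt (ENNReal.coe_lt_coe.2 hk)
  rw [this]
  exact MeasurableSet.iUnion fun k => MeasurableSet.iUnion fun hk => MeasurableSet.iInter fun n =>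
    (naturalFiltration d).mono hk.le _ (measurableSet_leaveTime_lt (hK n) _)

/-- The paths that up to and including time `t` stay in some compact subset of `D`. In contrast to
`{t < exitTime D}`, this set is measurable. -/
def survives (D : Set (Rd d)) (t : ℝ≥0) : Set (PathSpace d) :=
  {ω | ∃ K ⊆ D, IsCompact K ∧ ∀ s ≤ t, X s ω ∈ ((↑) : Rd d → OnePoint (Rd d)) '' K}

variable {K : ℕ → Set (Rd d)} {D : Set (Rd d)}

theorem mem_survives_iff (hK : IsExhaustion K D) {t : ℝ≥0} {ω : PathSpace d} :
    ω ∈ survives D t ↔ ∃ n, ∀ s ≤ t, X s ω ∈ ((↑) : Rd d → OnePoint (Rd d)) '' K n := by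
  constructor
  · rintro ⟨L, hLD, hL, h⟩
    obtain ⟨n, hn⟩ := hK.exists_superset hL hLD
    exact ⟨n, fun s hs => Set.image_mono hn (h s hs)⟩
  · rintro ⟨n, h⟩
    exact ⟨K n, hK.subset n, hK.isCompact n, h⟩

theorem mem_survives_iff_lt_limitLeaveTime (hK : IsExhaustion K D) {t : ℝ≥0}
    {ω : PathSpace d} : ω ∈ survives D t ↔ (t : ℝ≥0∞) < limitLeaveTime K ω := by
  rw [mem_survives_iff hK, limitLeaveTime, lt_iSup_iff]
  constructor
  · rintro ⟨n, h⟩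
    refine ⟨n + 1, ?_⟩
    by_contra! hle
    lift leaveTime (K (n + 1)) ω to ℝ≥0 using (ne_top_of_le_ne_top ENNReal.coe_ne_top hle)
      with s hs
    exact X_leaveTime_notMem (hK.isCompact _) hs.symm
      (Set.image_mono (hK.subset_interior n) (h s (ENNReal.coe_le_coe.1 hle)))
  · rintro ⟨n, h⟩
    refine ⟨n, fun s hs => ?_⟩
    by_contra hX
    exact absurd ((leaveTime_le (hK.isCompact n) hX).trans (ENNReal.coe_le_coe.2 hs)) (not_le.2 h)

theorem measurableSet_survives (hD : IsOpen D) (t : ℝ≥0) :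
    MeasurableSet[naturalFiltration d t] (survives D t) := by
  obtain ⟨K, hK⟩ := exists_isExhaustion hD
  have hcl := fun n => isClosed_image_coe (hK.isCompact n)
  have : survives D t = ⋃ n, (X t ⁻¹' (((↑) : Rd d → OnePoint (Rd d)) '' K n) ∩
      ⋂ (k : ℕ) (_ : denseSeq ℝ≥0 k ≤ t),
        X (denseSeq ℝ≥0 k) ⁻¹' (((↑) : Rd d → OnePoint (Rd d)) '' K n)) := by
    ext ω
    simp only [mem_survives_iff hK, Set.mem_iUnion, Set.mem_inter_iff, Set.mem_iInter,
      Set.mem_preimage]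
    refine exists_congr fun n => ⟨fun h => ⟨h t le_rfl, fun k hk => h _ hk⟩, ?_⟩
    rintro ⟨ht, h⟩ s hs
    rcases hs.eq_or_lt with rfl | hs
    · exact ht
    by_contra hX
    obtain ⟨r, hr, hX⟩ := exists_forall_X_mem (hcl n).isOpen_compl hX
    obtain ⟨k, hk1, hk2⟩ := exists_denseSeq_between (lt_min hr hs)
    exact hX _ hk1.le (hk2.trans_le (min_le_left _ _)) (h k (hk2.le.trans (min_le_right _ _)))
  rw [this]
  exact MeasurableSet.iUnion fun n =>
    (measurableSet_preimage_X le_rfl (hcl n).measurableSet).inter <|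
      MeasurableSet.iInter fun k => MeasurableSet.iInter fun hk =>
        measurableSet_preimage_X hk (hcl n).measurableSet

theorem survives_subset_exitTime (hD : IsOpen D) (t : ℝ≥0) :
    survives D t ⊆ {ω | (t : ℝ≥0∞) < exitTime D ω} := by
  intro ω hω
  obtain ⟨K, hK⟩ := exists_isExhaustion hD
  rw [mem_survives_iff_lt_limitLeaveTime hK, limitLeaveTime, lt_iSup_iff] at hω
  obtain ⟨n, hn⟩ := hω
  refine hn.trans_le (le_iInf fun s => le_iInf fun _ => le_iInf fun hs => ?_)
  exact leaveTime_le (hK.isCompact n) fun h => hs (Set.image_mono (hK.subset n) h)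

theorem exitTime_le {ω : PathSpace d} {s : ℝ≥0} (hs : 0 < s)
    (h : X s ω ∉ ((↑) : Rd d → OnePoint (Rd d)) '' D) : exitTime D ω ≤ s :=
  iInf_le_of_le s (iInf_le_of_le hs (iInf_le_of_le h le_rfl))

end PathSpace

/-! ### The path does not jump back into the domain from its boundary -/

section Exit

variable {d : ℕ} {A : LevyOperator d} {D : Set (Rd d)} {K : ℕ → Set (Rd d)}

@[simp] theorem extendZero_coe {M : Type*} [Zero M] (f : Rd d → M) (x : Rd d) :
    extendZero f (x : OnePoint (Rd d)) = f x := rfl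

@[simp] theorem extendZero_infty {M : Type*} [Zero M] (f : Rd d → M) :
    extendZero f (OnePoint.infty : OnePoint (Rd d)) = 0 := rfl

theorem abs_extendZero_le {f : Rd d → ℝ} {C : ℝ} (hf : ∀ x, |f x| ≤ C) (y : OnePoint (Rd d)) :
    |extendZero f y| ≤ C := by
  induction y using OnePoint.rec with
  | infty => simpa using (abs_nonneg _).trans (hf 0)
  | coe x => simpa using hf x

theorem abs_integral_extendZero_le {g : Rd d → ℝ} {C : ℝ} (hg : ∀ x, |g x| ≤ C)
    (ω : PathSpace d) (a b : ℝ) :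
    |∫ r in a..b, extendZero g (PathSpace.X r.toNNReal ω)| ≤ C * |b - a| := by
  rw [← Real.norm_eq_abs]
  refine intervalIntegral.norm_integral_le_of_norm_le_const fun r _ => ?_
  rw [Real.norm_eq_abs]
  exact abs_extendZero_le hg _

theorem abs_martingaleTerm_le {f : Rd d → ℝ} {C C' : ℝ} (hf : ∀ x, |f x| ≤ C)
    (hAf : ∀ x, |A.apply f x| ≤ C') {N t : ℝ≥0} (ht : t ≤ N) (ω : PathSpace d) :
    |A.martingaleTerm f t ω| ≤ C + C + C' * N := by
  have hC' : 0 ≤ C' := (abs_nonneg _).trans (hAf 0)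
  refine (abs_sub _ _).trans (add_le_add ((abs_sub _ _).trans
    (add_le_add (abs_extendZero_le hf _) (abs_extendZero_le hf _))) ?_)
  refine (abs_integral_extendZero_le hAf ω _ _).trans ?_
  rw [sub_zero, abs_of_nonneg t.coe_nonneg]
  gcongr

theorem abs_martingaleTerm_sub_le {f : Rd d → ℝ} {C' : ℝ} (hAf : ∀ x, |A.apply f x| ≤ C')
    {ω : PathSpace d} (hω : ∀ t : ℝ≥0, IntervalIntegrable
      (fun r : ℝ => extendZero (A.apply f) (PathSpace.X r.toNNReal ω)) volume 0 t) (s t : ℝ≥0) :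
    |(A.martingaleTerm f t ω - A.martingaleTerm f s ω)
      - (extendZero f (PathSpace.X t ω) - extendZero f (PathSpace.X s ω))|
      ≤ C' * |(t : ℝ) - s| := by
  have e : (A.martingaleTerm f t ω - A.martingaleTerm f s ω)
      - (extendZero f (PathSpace.X t ω) - extendZero f (PathSpace.X s ω))
      = -∫ r in (s : ℝ)..t, extendZero (A.apply f) (PathSpace.X r.toNNReal ω) := by
    rw [← intervalIntegral.integral_interval_sub_left (hω t) (hω s)]
    simp only [LevyOperator.martingaleTerm]
    ring
  rw [e, abs_neg]
  exact abs_integral_extendZero_le hAf ω _ _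

theorem continuousWithinAt_martingaleTerm {f : Rd d → ℝ} (hfc : Continuous f) {C' : ℝ}
    (hAf : ∀ x, |A.apply f x| ≤ C') {ω : PathSpace d}
    (hω : ∀ t : ℝ≥0, IntervalIntegrable
      (fun r : ℝ => extendZero (A.apply f) (PathSpace.X r.toNNReal ω)) volume 0 t)
    (hfin : ω ∈ PathSpace.finitePaths d) (t : ℝ≥0) :
    ContinuousWithinAt (fun s => A.martingaleTerm f s ω) (Set.Ici t) t := by
  obtain ⟨γ, hγ, hX⟩ := hfin
  have h1 : ContinuousWithinAt (fun s => extendZero f (PathSpace.X s ω)) (Set.Ici t) t := by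
    simp only [hX, extendZero_coe]
    exact hfc.continuousAt.comp_continuousWithinAt (hγ t).1
  have h2 : Continuous fun s : ℝ≥0 =>
      ∫ r in (0 : ℝ)..s, extendZero (A.apply f) (PathSpace.X r.toNNReal ω) := by
    refine (LipschitzWith.of_dist_le_mul (K := C'.toNNReal) fun s u => ?_).continuous
    rw [Real.dist_eq, intervalIntegral.integral_interval_sub_left (hω s) (hω u), NNReal.dist_eq,
      Real.coe_toNNReal _ ((abs_nonneg _).trans (hAf 0))]
    exact abs_integral_extendZero_le hAf ω _ _
  exact (h1.sub continuousWithinAt_const).sub h2.continuousWithinAt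

/-- Optional stopping for `M[f]` at the times of leaving `K n` and at their limit `σ`. The
difference of the two expectations tends to the expectation of `f (X_σ)` on `{σ ≤ N}`, because `f`
vanishes at the positions of the path when it leaves `K n`, for large `n`. -/
theorem ae_extendZero_X_limitLeaveTime_eq_zero (hA : A.Admissible D) (hK : IsExhaustion K D)
    {μ : Measure (Rd d)} {P : Measure (PathSpace d)} (hP : A.IsMartingaleSolution μ P)
    {f : Rd d → ℝ} (hf : ContDiff ℝ 2 f) (hf0 : ∀ x, 0 ≤ f x) {j : ℕ}
    (hfs : f.support = interior (K j)) (N : ℝ≥0) :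
    ∀ᵐ ω ∂P, PathSpace.limitLeaveTime K ω ≤ N →
      extendZero f (PathSpace.X (PathSpace.limitLeaveTime K ω).toNNReal ω) = 0 := by
  have := hP.isProbabilityMeasure
  have htsub : tsupport f ⊆ K j := by
    rw [tsupport, hfs]
    exact (hK.isCompact j).isClosed.closure_subset_iff.2 interior_subset
  have hfb : IsCb2 f := isCb2_of_hasCompactSupport hf
    (HasCompactSupport.of_support_subset_isCompact (hK.isCompact j)
      ((subset_tsupport f).trans htsub))
  obtain ⟨C', hC'⟩ := exists_abs_apply_le hA hfb (htsub.trans (hK.subset j))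
  obtain ⟨C, hC⟩ : ∃ C, ∀ x, |f x| ≤ C := by
    obtain ⟨-, C, hC⟩ := hfb
    exact ⟨C, fun x => by
      simpa only [norm_iteratedFDeriv_zero, Real.norm_eq_abs] using hC 0 (by norm_num) x⟩
  have hC'0 : 0 ≤ C' := (abs_nonneg _).trans (hC' 0)
  set σ := PathSpace.limitLeaveTime K
  let S : ℕ → PathSpace d → ℝ≥0∞ := fun n => PathSpace.leaveTime (K n)
  -- `M[f]` is bounded only on bounded time intervals, so all times are truncated at `N`.
  let cut : ℝ≥0∞ → ℝ≥0 := fun s => (min s N).toNNReal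
  have hcutle : ∀ s, cut s ≤ N := fun s =>
    ENNReal.toNNReal_mono ENNReal.coe_ne_top (min_le_right _ _)
  have hcutlt : ∀ (s : ℝ≥0∞) (r : ℝ≥0), cut s < r ↔ s < r ∨ N < r := by
    intro s r
    rw [← ENNReal.coe_lt_coe, ENNReal.coe_toNNReal
      (ne_top_of_le_ne_top ENNReal.coe_ne_top (min_le_right _ _)), min_lt_iff, ENNReal.coe_lt_coe]
  have hcutmeas : ∀ T : PathSpace d → ℝ≥0∞,
      (∀ s : ℝ≥0, MeasurableSet[PathSpace.naturalFiltration d s] {ω | T ω < s}) →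
      ∀ s : ℝ≥0, MeasurableSet[PathSpace.naturalFiltration d s] {ω | cut (T ω) < s} := by
    intro T hT s
    simp only [hcutlt]
    exact (hT s).union (MeasurableSet.const _)
  have hrc : ∀ᵐ ω ∂P, ∀ t,
      ContinuousWithinAt (fun s => A.martingaleTerm f s ω) (Set.Ici t) t := by
    filter_upwards [hP.integrable f hfb, hP.finite] with ω h1 h2
    exact fun t => continuousWithinAt_martingaleTerm hf.continuous hC' h1 h2 t
  have hopt : ∀ T : PathSpace d → ℝ≥0∞,
      (∀ s : ℝ≥0, MeasurableSet[PathSpace.naturalFiltration d s] {ω | T ω < s}) →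
      Integrable (fun ω => A.martingaleTerm f (cut (T ω)) ω) P ∧
      ∫ ω, A.martingaleTerm f (cut (T ω)) ω ∂P = ∫ ω, A.martingaleTerm f 0 ω ∂P :=
    fun T hT => integral_martingale_optional (hP.martingale f hfb) hrc (N := N)
      (fun t ht ω => abs_martingaleTerm_le hC hC' ht ω) (fun ω => hcutle _) (hcutmeas T hT)
  have hoptσ := hopt σ (PathSpace.measurableSet_limitLeaveTime_lt hK.isCompact)
  have hoptS := fun n => hopt (S n) (PathSpace.measurableSet_leaveTime_lt (hK.isCompact n))
  let F : ℕ → PathSpace d → ℝ := fun n ω =>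
    A.martingaleTerm f (cut (σ ω)) ω - A.martingaleTerm f (cut (S n ω)) ω
  have hFint : ∀ n, Integrable (F n) P := fun n => hoptσ.1.sub (hoptS n).1
  have hF0 : ∀ n, ∫ ω, F n ω ∂P = 0 := fun n => by
    rw [integral_sub hoptσ.1 (hoptS n).1, hoptσ.2, (hoptS n).2, sub_self]
  let G : PathSpace d → ℝ := {ω | σ ω ≤ N}.indicator
    fun ω => extendZero f (PathSpace.X (σ ω).toNNReal ω)
  have hSσ : ∀ ω, Tendsto (fun n => S n ω) atTop (𝓝 (σ ω)) := fun ω =>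
    tendsto_atTop_iSup fun a b hab => PathSpace.leaveTime_mono (hK.monotone hab) ω
  have hlim : ∀ᵐ ω ∂P, Tendsto (fun n => F n ω) atTop (𝓝 (G ω)) := by
    filter_upwards [hP.integrable f hfb] with ω hω
    by_cases hle : σ ω ≤ N
    · have hGω : G ω = extendZero f (PathSpace.X (σ ω).toNNReal ω) :=
        Set.indicator_of_mem (s := {ω | σ ω ≤ N}) hle _
      have hSle : ∀ n, S n ω ≤ σ ω := fun n => le_iSup (fun n => PathSpace.leaveTime (K n) ω) n
      have hcutσ : cut (σ ω) = (σ ω).toNNReal := by simp only [cut, min_eq_left hle]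
      have hcutS : ∀ n, cut (S n ω) = (S n ω).toNNReal := fun n => by
        simp only [cut, min_eq_left ((hSle n).trans hle)]
      have hSfin : ∀ n, S n ω ≠ ∞ := fun n =>
        ne_top_of_le_ne_top ENNReal.coe_ne_top ((hSle n).trans hle)
      have hσfin : σ ω ≠ ∞ := ne_top_of_le_ne_top ENNReal.coe_ne_top hle
      have hzero : ∀ n, j ≤ n → extendZero f (PathSpace.X (cut (S n ω)) ω) = 0 := by
        intro n hn
        have hnot := PathSpace.X_leaveTime_notMem (hK.isCompact n)
          (ENNReal.coe_toNNReal (hSfin n)).symm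
        rw [hcutS n]
        generalize PathSpace.X (S n ω).toNNReal ω = y at hnot
        induction y using OnePoint.rec with
        | infty => simp
        | coe x =>
          rw [extendZero_coe, ← Function.notMem_support, hfs]
          exact fun hx => hnot ⟨x, interior_mono (hK.monotone hn) hx, rfl⟩
      have hdiff : Tendsto (fun n => C' * |((cut (σ ω) : ℝ≥0) : ℝ) - cut (S n ω)|) atTop
          (𝓝 0) := by
        have h1 : Tendsto (fun n => ((cut (S n ω) : ℝ≥0) : ℝ)) atTop (𝓝 (cut (σ ω) : ℝ≥0)) := by
          simp only [hcutσ, hcutS]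
          exact (NNReal.continuous_coe.tendsto _).comp
            ((ENNReal.tendsto_toNNReal hσfin).comp (hSσ ω))
        simpa using ((h1.const_sub ((cut (σ ω) : ℝ≥0) : ℝ)).abs).const_mul C'
      rw [tendsto_iff_norm_sub_tendsto_zero]
      refine squeeze_zero' (Eventually.of_forall fun n => norm_nonneg _) ?_ hdiff
      filter_upwards [eventually_ge_atTop j] with n hn
      have := abs_martingaleTerm_sub_le hC' hω (cut (S n ω)) (cut (σ ω))
      rwa [hzero n hn, sub_zero, hcutσ, ← hGω, ← hcutσ] at this
    · have hGω : G ω = 0 := Set.indicator_of_notMem (s := {ω | σ ω ≤ N}) hle _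
      rw [hGω]
      refine tendsto_const_nhds.congr' ?_
      filter_upwards [(hSσ ω).eventually (lt_mem_nhds (not_le.1 hle))] with n hn
      simp only [F, cut, min_eq_right hn.le, min_eq_right (not_le.1 hle).le, sub_self]
  have hFb : ∀ n, ∀ᵐ ω ∂P, ‖F n ω‖ ≤ (C + C + C' * N) + (C + C + C' * N) := fun n =>
    Eventually.of_forall fun ω => (norm_sub_le _ _).trans
      (add_le_add (abs_martingaleTerm_le hC hC' (hcutle _) ω)
        (abs_martingaleTerm_le hC hC' (hcutle _) ω))
  have hGm : AEStronglyMeasurable G P :=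
    aestronglyMeasurable_of_tendsto_ae atTop (fun n => (hFint n).1) hlim
  have hG0 : 0 ≤ᵐ[P] G := by
    refine Eventually.of_forall fun ω => Set.indicator_nonneg (fun ω _ => ?_) ω
    generalize PathSpace.X (σ ω).toNNReal ω = y
    induction y using OnePoint.rec with
    | infty => simp
    | coe x => simpa using hf0 x
  have hGb : ∀ ω, ‖G ω‖ ≤ C := fun ω =>
    (norm_indicator_le_norm_self _ _).trans (abs_extendZero_le hC _)
  have hGi : Integrable G P := ⟨hGm, HasFiniteIntegral.of_bounded (Eventually.of_forall hGb)⟩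
  have hGint : ∫ ω, G ω ∂P = 0 := by
    have := tendsto_integral_of_dominated_convergence _ (fun n => (hFint n).1)
      (integrable_const _) hFb hlim
    simp only [hF0] at this
    exact tendsto_nhds_unique this tendsto_const_nhds
  filter_upwards [(integral_eq_zero_iff_of_nonneg_ae hG0 hGi).1 hGint] with ω hω hle
  rwa [← Set.indicator_of_mem (s := {ω | σ ω ≤ N}) hle
    (fun ω => extendZero f (PathSpace.X (σ ω).toNNReal ω))]

/-- At the first time at which the path or its left limit is outside `D`, the path itself is
outside `D`: almost surely it does not jump back into `D` from a left limit on the boundary. -/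
theorem ae_X_limitLeaveTime_notMem (hA : A.Admissible D) (hK : IsExhaustion K D)
    {μ : Measure (Rd d)} {P : Measure (PathSpace d)} (hP : A.IsMartingaleSolution μ P) :
    ∀ᵐ ω ∂P, PathSpace.limitLeaveTime K ω ≠ ∞ →
      PathSpace.X (PathSpace.limitLeaveTime K ω).toNNReal ω
        ∉ ((↑) : Rd d → OnePoint (Rd d)) '' D := by
  have h : ∀ j : ℕ, ∃ f : Rd d → ℝ, f.support = interior (K j) ∧ ContDiff ℝ 2 f ∧
      Set.range f ⊆ Set.Icc 0 1 := fun j => isOpen_interior.exists_contDiff_support_eq (n := 2)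
  choose f hfs hfd hfr using h
  have hall : ∀ᵐ ω ∂P, ∀ j N : ℕ, PathSpace.limitLeaveTime K ω ≤ (N : ℝ≥0) →
      extendZero (f j) (PathSpace.X (PathSpace.limitLeaveTime K ω).toNNReal ω) = 0 :=
    ae_all_iff.2 fun j => ae_all_iff.2 fun N => ae_extendZero_X_limitLeaveTime_eq_zero hA hK hP
      (hfd j) (fun x => (hfr j ⟨x, rfl⟩).1) (hfs j) N
  filter_upwards [hall] with ω hω hfin
  rintro ⟨x, hxD, hx⟩
  rw [← hK.iUnion_interior, Set.mem_iUnion] at hxD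
  obtain ⟨j, hj⟩ := hxD
  obtain ⟨N, hN⟩ := ENNReal.exists_nat_gt hfin
  have := hω j N (by exact_mod_cast hN.le)
  rw [← hx, extendZero_coe] at this
  rw [← hfs j] at hj
  exact hj this

theorem survives_ae_eq_exitTime (hD : IsOpen D) (hA : A.Admissible D) {x : Rd d} (hx : x ∈ D)
    {P : Measure (PathSpace d)} (hP : A.IsMartingaleSolution (Measure.dirac x) P) (t : ℝ≥0) :
    ({ω | (t : ℝ≥0∞) < PathSpace.exitTime D ω} : Set (PathSpace d)) =ᵐ[P]
      PathSpace.survives D t := by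
  obtain ⟨K, hK⟩ := exists_isExhaustion hD
  have := hP.isProbabilityMeasure
  have hX0 : ∀ᵐ ω ∂P, PathSpace.X 0 ω = (x : OnePoint (Rd d)) := by
    have h1 := hP.initial {x} (measurableSet_singleton x)
    rw [Measure.dirac_apply_of_mem (Set.mem_singleton x), Set.image_singleton] at h1
    have hm : MeasurableSet {ω : PathSpace d | PathSpace.X 0 ω ∈ ({↑x} : Set (OnePoint (Rd d)))} :=
      PathSpace.measurable_X 0 (measurableSet_singleton _)
    exact (prob_compl_eq_zero_iff hm).2 h1
  refine EventuallyLE.antisymm ?_ (LE.le.eventuallyLE (PathSpace.survives_subset_exitTime hD t))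
  filter_upwards [ae_X_limitLeaveTime_notMem hA hK hP, hX0] with ω hω h0 hlt
  change ω ∈ PathSpace.survives D t
  rw [PathSpace.mem_survives_iff_lt_limitLeaveTime hK]
  by_contra! hle
  have hfin := ne_top_of_le_ne_top ENNReal.coe_ne_top hle
  have hnot := hω hfin
  refine absurd (show (t : ℝ≥0∞) < PathSpace.exitTime D ω from hlt) (not_lt.2 ?_)
  refine (PathSpace.exitTime_le ?_ hnot).trans ((ENNReal.coe_toNNReal hfin).le.trans hle)
  -- The exit time is an infimum over positive times, so `σ = 0` has to be excluded separately:
  -- the path starts in the open set `D`.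
  rw [pos_iff_ne_zero]
  intro hz
  rw [hz, h0] at hnot
  exact hnot ⟨x, hx, rfl⟩

end Exit

/-! ### Resolvents of sub-Markov semigroups -/

section Resolvent

variable {α : Type*} [MeasurableSpace α]

/-- Transition functions of a sub-Markov semigroup on `α`, as a kernel from `ℝ≥0 × α` (so that they
are jointly measurable in time and starting point). Neither continuity in time nor `κ (0, x) = δ_x`
is required. -/
structure IsSubMarkovSemigroup (κ : Kernel (ℝ≥0 × α) α) : Prop where
  apply_univ_le : ∀ p, κ p Set.univ ≤ 1
  apply_add : ∀ (s t : ℝ≥0) (x : α) (Z : Set α), MeasurableSet Z →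
    κ (s + t, x) Z = ∫⁻ y, κ (t, y) Z ∂(κ (s, x))

/-- The resolvent `∫₀^∞ e^{-βt} κ_t f dt` of the transition functions `κ`. -/
noncomputable def timeResolvent (κ : Kernel (ℝ≥0 × α) α) (β : ℝ) (f : α → ℝ≥0∞) (x : α) : ℝ≥0∞ :=
  ∫⁻ t in Set.Ioi (0 : ℝ),
    ENNReal.ofReal (Real.exp (-β * t)) * ∫⁻ y, f y ∂(κ (t.toNNReal, x))

theorem lintegral_ofReal_exp_neg : ∫⁻ t in Set.Ioi (0 : ℝ), ENNReal.ofReal (Real.exp (-t)) = 1 := by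
  rw [← ofReal_integral_eq_lintegral_ofReal (integrableOn_exp_neg_Ioi 0)
    (Eventually.of_forall fun t => (Real.exp_pos _).le), integral_exp_neg_Ioi_zero,
    ENNReal.ofReal_one]

variable {κ : Kernel (ℝ≥0 × α) α} {f : α → ℝ≥0∞}

theorem measurable_lintegral_toNNReal (κ : Kernel (ℝ≥0 × α) α) (hf : Measurable f) :
    Measurable fun p : ℝ × α => ∫⁻ y, f y ∂(κ (p.1.toNNReal, p.2)) :=
  hf.lintegral_kernel.comp
    (f := fun p : ℝ × α => ((p.1.toNNReal, p.2) : ℝ≥0 × α)) (by fun_prop)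

theorem measurable_timeResolvent_integrand (κ : Kernel (ℝ≥0 × α) α) (hf : Measurable f) (β : ℝ) :
    Measurable fun p : ℝ × α =>
      ENNReal.ofReal (Real.exp (-β * p.1)) * ∫⁻ y, f y ∂(κ (p.1.toNNReal, p.2)) :=
  (by fun_prop : Measurable fun p : ℝ × α => ENNReal.ofReal (Real.exp (-β * p.1))).mul
    (measurable_lintegral_toNNReal κ hf)

theorem measurable_timeResolvent_integrand_left (κ : Kernel (ℝ≥0 × α) α) (hf : Measurable f) (β : ℝ)
    (x : α) : Measurable fun t : ℝ =>
      ENNReal.ofReal (Real.exp (-β * t)) * ∫⁻ y, f y ∂(κ (t.toNNReal, x)) :=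
  (measurable_timeResolvent_integrand κ hf β).comp measurable_prodMk_right

theorem measurable_timeResolvent (κ : Kernel (ℝ≥0 × α) α) (hf : Measurable f) (β : ℝ) :
    Measurable (timeResolvent κ β f) :=
  (measurable_timeResolvent_integrand κ hf β).lintegral_prod_left'

theorem timeResolvent_mono {g : α → ℝ≥0∞} {β γ : ℝ} (hβ : γ ≤ β) (hfg : ∀ x, f x ≤ g x) (x : α) :
    timeResolvent κ β f x ≤ timeResolvent κ γ g x := by
  refine setLIntegral_mono' measurableSet_Ioi fun t ht => ?_
  refine mul_le_mul' (ENNReal.ofReal_le_ofReal (Real.exp_le_exp.2 ?_)) (lintegral_mono hfg)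
  have := mul_le_mul_of_nonneg_right hβ (le_of_lt ht)
  linarith

/-- Whether the resolvent vanishes does not depend on its parameter. -/
theorem timeResolvent_eq_zero_of_eq_zero (hf : Measurable f) {β : ℝ} (γ : ℝ) {x : α}
    (h : timeResolvent κ β f x = 0) : timeResolvent κ γ f x = 0 := by
  rw [timeResolvent,
    lintegral_eq_zero_iff (measurable_timeResolvent_integrand_left κ hf _ x)] at h ⊢
  filter_upwards [h] with t ht
  rw [Pi.zero_apply, mul_eq_zero] at ht ⊢
  exact Or.inr (ht.resolve_left (ENNReal.ofReal_pos.2 (Real.exp_pos _)).ne')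

namespace IsSubMarkovSemigroup

theorem isFiniteMeasure (hκ : IsSubMarkovSemigroup κ) (p : ℝ≥0 × α) : IsFiniteMeasure (κ p) :=
  ⟨(hκ.apply_univ_le p).trans_lt ENNReal.one_lt_top⟩

theorem isFiniteKernel (hκ : IsSubMarkovSemigroup κ) : IsFiniteKernel κ :=
  ⟨1, ENNReal.one_lt_top, hκ.apply_univ_le⟩

theorem lintegral_add (hκ : IsSubMarkovSemigroup κ) (hf : Measurable f) (s t : ℝ≥0) (x : α) :
    ∫⁻ y, f y ∂(κ (s + t, x)) = ∫⁻ y, ∫⁻ z, f z ∂(κ (t, y)) ∂(κ (s, x)) := by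
  have hm : Measurable fun y => κ (t, y) := κ.measurable.comp measurable_prodMk_left
  have : κ (s + t, x) = (κ (s, x)).bind fun y => κ (t, y) := by
    ext Z hZ
    rw [hκ.apply_add s t x Z hZ, Measure.bind_apply hZ hm.aemeasurable]
  rw [this, Measure.lintegral_bind hm.aemeasurable hf.aemeasurable]

theorem lintegral_timeResolvent (hκ : IsSubMarkovSemigroup κ) (hf : Measurable f) (β : ℝ) (s : ℝ≥0)
    (x : α) : ∫⁻ y, timeResolvent κ β f y ∂(κ (s, x)) = ENNReal.ofReal (Real.exp (β * s)) *
      ∫⁻ t in Set.Ioi (s : ℝ),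
        ENNReal.ofReal (Real.exp (-β * t)) * ∫⁻ y, f y ∂(κ (t.toNNReal, x)) := by
  have := hκ.isFiniteMeasure
  have hswap : ∫⁻ y, timeResolvent κ β f y ∂(κ (s, x)) = ∫⁻ t in Set.Ioi (0 : ℝ),
      ∫⁻ y, ENNReal.ofReal (Real.exp (-β * t)) * ∫⁻ z, f z ∂(κ (t.toNNReal, y)) ∂(κ (s, x)) :=
    lintegral_lintegral_swap
      ((measurable_timeResolvent_integrand κ hf β).comp measurable_swap).aemeasurable
  have hm := measurable_timeResolvent_integrand_left κ hf β x
  rw [hswap, ← lintegral_const_mul _ hm, ← lintegral_indicator measurableSet_Ioi,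
    ← lintegral_indicator measurableSet_Ioi,
    ← lintegral_add_left_eq_self (μ := volume) ((Set.Ioi (s : ℝ)).indicator _) (s : ℝ)]
  refine lintegral_congr fun t => ?_
  by_cases ht : 0 < t
  · have hs : (s : ℝ) + t ∈ Set.Ioi (s : ℝ) := by simpa using ht
    have hmt : Measurable fun y => ∫⁻ z, f z ∂(κ (t.toNNReal, y)) :=
      (measurable_lintegral_toNNReal κ hf).comp measurable_prodMk_left
    rw [Set.indicator_of_mem (show t ∈ Set.Ioi (0 : ℝ) from ht), Set.indicator_of_mem hs,
      lintegral_const_mul _ hmt,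
      ← hκ.lintegral_add hf, ← mul_assoc, ← ENNReal.ofReal_mul (Real.exp_pos _).le,
      ← Real.exp_add, Real.toNNReal_add s.coe_nonneg ht.le, Real.toNNReal_coe]
    congr 3
    ring
  · have hs : (s : ℝ) + t ∉ Set.Ioi (s : ℝ) := by simpa using ht
    rw [Set.indicator_of_notMem (show t ∉ Set.Ioi (0 : ℝ) from ht), Set.indicator_of_notMem hs]

theorem lintegral_timeResolvent_le (hκ : IsSubMarkovSemigroup κ) (hf : Measurable f) (β : ℝ)
    (s : ℝ≥0) (x : α) : ∫⁻ y, timeResolvent κ β f y ∂(κ (s, x)) ≤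
      ENNReal.ofReal (Real.exp (β * s)) * timeResolvent κ β f x := by
  rw [hκ.lintegral_timeResolvent hf]
  gcongr
  exact lintegral_mono_set (Set.Ioi_subset_Ioi s.coe_nonneg)

theorem tendsto_lintegral_timeResolvent (hκ : IsSubMarkovSemigroup κ) (hf : Measurable f) (β : ℝ)
    {x : α} (hfin : timeResolvent κ β f x ≠ ∞) :
    Tendsto (fun s : ℝ≥0 => ∫⁻ y, timeResolvent κ β f y ∂(κ (s, x))) (𝓝[>] 0)
      (𝓝 (timeResolvent κ β f x)) := by
  simp only [hκ.lintegral_timeResolvent hf]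
  let g : ℝ → ℝ≥0∞ := fun t =>
    ENNReal.ofReal (Real.exp (-β * t)) * ∫⁻ y, f y ∂(κ (t.toNNReal, x))
  have h1 : Tendsto (fun s : ℝ≥0 => ENNReal.ofReal (Real.exp (β * s))) (𝓝[>] 0) (𝓝 1) := by
    have : Continuous fun s : ℝ≥0 => ENNReal.ofReal (Real.exp (β * s)) :=
      ENNReal.continuous_ofReal.comp (by fun_prop)
    simpa using (this.tendsto 0).mono_left nhdsWithin_le_nhds
  have h2 : Tendsto (fun s : ℝ≥0 => ∫⁻ t in Set.Ioc (0 : ℝ) s, g t) (𝓝[>] 0) (𝓝 0) := by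
    have h3 : Tendsto (fun s : ℝ≥0 => ∫⁻ t in Set.Ioc (0 : ℝ) s, g t ∂(volume.restrict (Set.Ioi 0)))
        (𝓝[>] 0) (𝓝 0) := by
      refine tendsto_setLIntegral_zero hfin ?_
      have h4 : Continuous fun s : ℝ≥0 => ENNReal.ofReal s :=
        ENNReal.continuous_ofReal.comp NNReal.continuous_coe
      refine tendsto_of_tendsto_of_tendsto_of_le_of_le tendsto_const_nhds
        (by simpa using (h4.tendsto 0).mono_left nhdsWithin_le_nhds) (fun _ => zero_le) fun s => ?_
      refine (Measure.restrict_apply_le _ _).trans ?_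
      simp
    refine h3.congr fun s => ?_
    rw [Measure.restrict_restrict measurableSet_Ioc,
      Set.inter_eq_left.2 Set.Ioc_subset_Ioi_self]
  have h5 : ∀ s : ℝ≥0, ∫⁻ t in Set.Ioi (s : ℝ), g t =
      timeResolvent κ β f x - ∫⁻ t in Set.Ioc (0 : ℝ) s, g t := by
    intro s
    have h6 : timeResolvent κ β f x =
        (∫⁻ t in Set.Ioc (0 : ℝ) s, g t) + ∫⁻ t in Set.Ioi (s : ℝ), g t := by
      rw [← lintegral_union measurableSet_Ioi (Set.Ioc_disjoint_Ioi le_rfl),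
        Set.Ioc_union_Ioi_eq_Ioi s.coe_nonneg]
      rfl
    rw [h6, ENNReal.add_sub_cancel_left]
    exact ne_top_of_le_ne_top hfin (h6 ▸ le_self_add)
  have h7 := ENNReal.Tendsto.mul h1 (Or.inl one_ne_zero)
    (ENNReal.Tendsto.sub (tendsto_const_nhds (x := timeResolvent κ β f x)) h2 (Or.inl hfin))
    (Or.inr ENNReal.one_ne_top)
  simpa only [h5, g, one_mul, tsub_zero] using h7

/-- Since `κ_t R_a f ≤ e^{at} R_a f`, integrating against `e^{-(a+1)t} dt` gives at most `R_a f`. -/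
theorem timeResolvent_timeResolvent_le (hκ : IsSubMarkovSemigroup κ) (hf : Measurable f)
    (a : ℝ) (x : α) :
    timeResolvent κ (a + 1) (timeResolvent κ a f) x ≤ timeResolvent κ a f x := by
  calc timeResolvent κ (a + 1) (timeResolvent κ a f) x
      ≤ ∫⁻ t in Set.Ioi (0 : ℝ), ENNReal.ofReal (Real.exp (-t)) * timeResolvent κ a f x := by
        refine setLIntegral_mono' measurableSet_Ioi fun t ht => ?_
        refine (mul_le_mul' le_rfl (hκ.lintegral_timeResolvent_le hf a _ x)).trans_eq ?_
        rw [← mul_assoc, ← ENNReal.ofReal_mul (Real.exp_pos _).le, ← Real.exp_add,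
          Real.coe_toNNReal _ (le_of_lt ht)]
        congr 3
        ring
    _ = timeResolvent κ a f x := by
        rw [lintegral_mul_const _ (by fun_prop), lintegral_ofReal_exp_neg, one_mul]

/-- For parameters `β ≥ 1` the resolvent is a kernel of total mass at most one. -/
theorem exists_resolvent_kernel (hκ : IsSubMarkovSemigroup κ) {β : ℝ} (hβ : 1 ≤ β) :
    ∃ U : Kernel α α, (∀ x, U x Set.univ ≤ 1) ∧
      ∀ f : α → ℝ≥0∞, Measurable f → ∀ x, ∫⁻ y, f y ∂(U x) = timeResolvent κ β f x := by
  have := hκ.isFiniteKernel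
  let ρ : Measure ℝ≥0 := ((volume.restrict (Set.Ioi (0 : ℝ))).withDensity
    fun t => ENNReal.ofReal (Real.exp (-β * t))).map Real.toNNReal
  -- Starting from `x`, a time is drawn from `ρ` while `x` is kept, and then `κ` is applied.
  let U : Kernel α α := κ ∘ₖ (Kernel.const α ρ ×ₖ Kernel.id)
  have hU : ∀ f : α → ℝ≥0∞, Measurable f → ∀ x, ∫⁻ y, f y ∂(U x) = timeResolvent κ β f x := by
    intro f hf x
    have h1 : Measurable fun t : ℝ≥0 => ∫⁻ y, f y ∂(κ (t, x)) :=
      hf.lintegral_kernel.comp measurable_prodMk_right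
    have h2 : Measurable fun t : ℝ => ∫⁻ y, f y ∂(κ (t.toNNReal, x)) :=
      h1.comp measurable_real_toNNReal
    rw [Kernel.lintegral_comp _ _ _ hf, Kernel.lintegral_prod_id hf.lintegral_kernel,
      Kernel.const_apply, lintegral_map h1 (by fun_prop)]
    exact lintegral_withDensity_eq_lintegral_mul _ (by fun_prop) h2
  refine ⟨U, fun x => ?_, hU⟩
  have h := hU 1 measurable_one x
  simp only [Pi.one_apply, lintegral_one] at h
  rw [h, ← lintegral_ofReal_exp_neg]
  refine setLIntegral_mono' measurableSet_Ioi fun t ht => ?_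
  rw [← mul_one (ENNReal.ofReal (Real.exp (-t)))]
  refine mul_le_mul' (ENNReal.ofReal_le_ofReal (Real.exp_le_exp.2 ?_)) ?_
  · have := mul_le_mul_of_nonneg_right hβ (le_of_lt ht)
    linarith
  · simpa using hκ.apply_univ_le (t.toNNReal, x)

end IsSubMarkovSemigroup

end Resolvent

/-! ### Measurability in time of the canonical process -/

instance metrizableSpace_onePoint (d : ℕ) : TopologicalSpace.MetrizableSpace (OnePoint (Rd d)) :=
  (onePointEquivSphereOfFinrankEq (ι := Fin (d + 1)) (V := Rd d)
    (by simp)).isEmbedding.metrizableSpace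

namespace PathSpace

open TopologicalSpace

variable {d : ℕ}

theorem measurable_X_uncurry : Measurable fun p : ℝ≥0 × PathSpace d => X p.1 p.2 := by
  refine measurable_of_tendsto_metrizable (f := fun k (p : ℝ≥0 × PathSpace d) =>
    X (gridAbove k p.1) p.2) (fun k => ?_) (tendsto_pi_nhds.2 fun p => ?_)
  · have h : Measurable fun q : ℕ × PathSpace d => X (((q.1 : ℝ≥0) + 1) / 2 ^ k) q.2 :=
      measurable_from_prod_countable_right fun n => measurable_X (((n : ℝ≥0) + 1) / 2 ^ k)
    exact h.comp (f := fun p : ℝ≥0 × PathSpace d => (⌊p.1 * 2 ^ k⌋₊, p.2))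
      ((Nat.measurable_floor.comp (measurable_fst.mul_const _)).prodMk measurable_snd)
  · exact (continuousWithinAt_X p.2 p.1).tendsto.comp (tendsto_gridAbove p.1)

theorem measurable_leaveTime {K : Set (Rd d)} (hK : IsCompact K) : Measurable (leaveTime K) := by
  classical
  refine Measurable.iInf fun n => ?_
  simp only [iInf_eq_if]
  exact Measurable.ite (measurable_X _ (isClosed_image_coe hK).measurableSet.compl)
    measurable_const measurable_const

theorem measurableSet_survives_uncurry {D : Set (Rd d)} (hD : IsOpen D) :
    MeasurableSet {p : ℝ≥0 × PathSpace d | p.2 ∈ survives D p.1} := by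
  obtain ⟨K, hK⟩ := exists_isExhaustion hD
  simp only [mem_survives_iff_lt_limitLeaveTime hK]
  exact measurableSet_lt (measurable_coe_nnreal_ennreal.comp measurable_fst)
    ((Measurable.iSup fun n => measurable_leaveTime (hK.isCompact n)).comp measurable_snd)

theorem survives_add (D : Set (Rd d)) (s t : ℝ≥0) :
    survives D (s + t) = survives D s ∩ shift s ⁻¹' survives D t := by
  ext ω
  constructor
  · rintro ⟨K, hKD, hK, h⟩
    exact ⟨⟨K, hKD, hK, fun u hu => h u (hu.trans le_self_add)⟩,
      ⟨K, hKD, hK, fun u hu => h (s + u) (add_le_add_right hu s)⟩⟩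
  · rintro ⟨⟨K, hKD, hK, h⟩, ⟨L, hLD, hL, h'⟩⟩
    refine ⟨K ∪ L, Set.union_subset hKD hLD, hK.union hL, fun u hu => ?_⟩
    rcases le_total u s with hus | hus
    · exact Set.image_mono Set.subset_union_left (h u hus)
    · obtain ⟨v, rfl⟩ := exists_add_of_le hus
      exact Set.image_mono Set.subset_union_right (h' v (le_of_add_le_add_left hu))

end PathSpace

/-! ### The killed semigroup as a semigroup of kernels -/

section KilledKernel

variable {d : ℕ} {A : LevyOperator d} {P : Rd d → Measure (PathSpace d)} {D : Set (Rd d)}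

/-- The inclusion of `D` into the one-point compactification. -/
def coeOnePoint (D : Set (Rd d)) (y : D) : OnePoint (Rd d) := (y : Rd d)

theorem measurableEmbedding_coeOnePoint (hD : IsOpen D) :
    MeasurableEmbedding (coeOnePoint D) :=
  OnePoint.isOpenEmbedding_coe.measurableEmbedding.comp
    (MeasurableEmbedding.subtype_coe hD.measurableSet)

theorem exists_coeOnePoint_of_mem_survives {t : ℝ≥0} {ω : PathSpace d}
    (h : ω ∈ PathSpace.survives D t) : ∃ y, PathSpace.X t ω = coeOnePoint D y := by
  obtain ⟨K, hKD, -, h⟩ := h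
  obtain ⟨y, hy, hyX⟩ := h t le_rfl
  exact ⟨⟨y, hKD hy⟩, hyX.symm⟩

/-- The law of `X_t` under `P x` on the event that the path survives in `D` until time `t`. -/
noncomputable def killedMeasure (P : Rd d → Measure (PathSpace d)) (D : Set (Rd d))
    (t : ℝ≥0) (x : D) : Measure D :=
  (((P x).restrict (PathSpace.survives D t)).map (PathSpace.X t)).comap (coeOnePoint D)

theorem killedMeasure_apply (hD : IsOpen D) (t : ℝ≥0) (x : D) {Z : Set D} (hZ : MeasurableSet Z) :
    killedMeasure P D t x Z =
      P x (PathSpace.survives D t ∩ PathSpace.X t ⁻¹' (coeOnePoint D '' Z)) := by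
  have hι := measurableEmbedding_coeOnePoint hD
  have hZ' := hι.measurableSet_image.2 hZ
  rw [killedMeasure, hι.comap_apply, Measure.map_apply (PathSpace.measurable_X t) hZ',
    Measure.restrict_apply (PathSpace.measurable_X t hZ'), Set.inter_comm]

theorem lintegral_killedMeasure (hD : IsOpen D) (t : ℝ≥0) (x : D) {f : D → ℝ≥0∞}
    (hf : Measurable f) : ∫⁻ y, f y ∂(killedMeasure P D t x) =
      ∫⁻ ω in PathSpace.survives D t,
        Function.extend (coeOnePoint D) f 0 (PathSpace.X t ω) ∂(P x) := by
  have hι := measurableEmbedding_coeOnePoint hD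
  set g : OnePoint (Rd d) → ℝ≥0∞ := Function.extend (coeOnePoint D) f 0
  have hgm : Measurable g := hι.measurable_extend hf measurable_const
  have hgι : ∀ y, f y = g (coeOnePoint D y) := fun y => (hι.injective.extend_apply _ _ y).symm
  have h0 : ∀ z ∉ Set.range (coeOnePoint D), g z = 0 := fun z hz =>
    Function.extend_apply' _ _ _ hz
  simp only [hgι]
  rw [← hι.lintegral_map, killedMeasure, hι.map_comap,
    ← lintegral_map hgm (PathSpace.measurable_X t), ← lintegral_indicator hι.measurableSet_range]
  congr 1
  ext z
  by_cases hz : z ∈ Set.range (coeOnePoint D)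
  · rw [Set.indicator_of_mem hz]
  · rw [Set.indicator_of_notMem hz, h0 z hz]

theorem killedSemigroup_eq (hD : IsOpen D) (hA : A.Admissible D) (hP : IsStrongMarkovSolution A P)
    (t : ℝ≥0) {f : D → ℝ≥0} (hf : Measurable f) (x : D) :
    killedSemigroup P D t f x = ∫⁻ y, f y ∂(killedMeasure P D t x) := by
  have hι := measurableEmbedding_coeOnePoint hD
  rw [killedSemigroup, lintegral_killedMeasure hD t x hf.coe_nnreal_ennreal,
    Measure.restrict_congr_set (survives_ae_eq_exitTime hD hA x.2 (hP.solution x) t)]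
  have hmeas := (PathSpace.naturalFiltration d).le t _ (PathSpace.measurableSet_survives hD t)
  refine setLIntegral_congr_fun hmeas fun ω hω => ?_
  obtain ⟨y, hy⟩ := exists_coeOnePoint_of_mem_survives hω
  simp only [hy]
  rw [hι.injective.extend_apply, coeOnePoint, extendZero_coe,
    Subtype.val_injective.extend_apply]

theorem measurable_killedMeasure (hD : IsOpen D) (hP : IsStrongMarkovSolution A P) :
    Measurable fun p : ℝ≥0 × D => killedMeasure P D p.1 p.2 := by
  have hι := measurableEmbedding_coeOnePoint hD
  let κ : Kernel (ℝ≥0 × D) (PathSpace d) :=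
    ⟨fun p => P p.2, (Measure.measurable_of_measurable_coe _ hP.measurable).comp
      (measurable_subtype_coe.comp measurable_snd)⟩
  have : IsMarkovKernel κ := ⟨fun p => (hP.solution p.2).isProbabilityMeasure⟩
  refine Measure.measurable_of_measurable_coe _ fun Z hZ => ?_
  simp only [killedMeasure_apply hD _ _ hZ]
  have hm : MeasurableSet {q : (ℝ≥0 × D) × PathSpace d | q.2 ∈ PathSpace.survives D q.1.1 ∩
      PathSpace.X q.1.1 ⁻¹' (coeOnePoint D '' Z)} := by
    have hq : Measurable fun q : (ℝ≥0 × D) × PathSpace d => (q.1.1, q.2) := by fun_prop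
    exact (hq (PathSpace.measurableSet_survives_uncurry hD)).inter
      ((PathSpace.measurable_X_uncurry.comp hq) (hι.measurableSet_image.2 hZ))
  exact Kernel.measurable_kernel_prodMk_left (κ := κ) hm

/-- The transition functions of the process killed on leaving `D`. -/
noncomputable def killedKernel (hD : IsOpen D) (hP : IsStrongMarkovSolution A P) :
    Kernel (ℝ≥0 × D) D :=
  ⟨fun p => killedMeasure P D p.1 p.2, measurable_killedMeasure hD hP⟩

/-- The Markov property at the constant time `s`, on the event of survival until `s`. -/
theorem killedMeasure_add (hD : IsOpen D) (hP : IsStrongMarkovSolution A P) (s t : ℝ≥0) (x : D)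
    {Z : Set D} (hZ : MeasurableSet Z) : killedMeasure P D (s + t) x Z =
      ∫⁻ y, killedMeasure P D t y Z ∂(killedMeasure P D s x) := by
  have hι := measurableEmbedding_coeOnePoint hD
  have hZ' := hι.measurableSet_image.2 hZ
  have hmeas := fun t => (PathSpace.naturalFiltration d).le t _
    (PathSpace.measurableSet_survives hD t)
  have hB : MeasurableSet[(isStoppingTime_const (PathSpace.naturalFiltration d) s).measurableSpace]
      (PathSpace.survives D s) := by
    rw [IsStoppingTime.measurableSpace_const]
    exact PathSpace.measurableSet_survives hD s
  have hMarkov := hP.strongMarkov x (fun _ => (s : WithTop ℝ≥0)) (isStoppingTime_const _ s)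
    (PathSpace.survives D s) hB
    (PathSpace.survives D t ∩ PathSpace.X t ⁻¹' (coeOnePoint D '' Z))
    ((hmeas t).inter (PathSpace.measurable_X t hZ'))
  simp only [ne_eq, WithTop.coe_ne_top, not_false_eq_true, true_and, and_true,
    WithTop.untopD_coe, Set.ofPred_mem_eq] at hMarkov
  have hmk : Measurable fun y : D => killedMeasure P D t y Z :=
    (Measure.measurable_coe hZ).comp ((measurable_killedMeasure hD hP).comp measurable_prodMk_left)
  rw [killedMeasure_apply hD _ _ hZ, lintegral_killedMeasure hD s x hmk, PathSpace.survives_add]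
  refine (congrArg (P x) ?_).trans (hMarkov.trans (setLIntegral_congr_fun (hmeas s) fun ω hω => ?_))
  · ext ω
    exact and_assoc
  · obtain ⟨y, hy⟩ := exists_coeOnePoint_of_mem_survives hω
    simp only [hy]
    rw [hι.injective.extend_apply, killedMeasure_apply hD _ _ hZ]
    rfl

end KilledKernel

/-! ### The minorization of the killed resolvent -/

/-- The resolvent of an irreducible semigroup dominates a rank-one kernel. The square of `R_{a+1}`
does so on a product set, one more factor on the left spreads this to all starting points, one more
factor on the right to all sets of positive measure, and `R_a` dominates the iterates of
`R_{a+1}`. -/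
theorem IsSubMarkovSemigroup.exists_minorization {α : Type*} [MeasurableSpace α]
    [MeasurableSpace.CountablyGenerated α] {κ : Kernel (ℝ≥0 × α) α}
    (hκ : IsSubMarkovSemigroup κ) (m : Measure α) [IsProbabilityMeasure m] {a : ℝ} (ha : 0 ≤ a)
    (hm : ∀ Z, MeasurableSet Z → m Z ≠ 0 →
      ∀ x, timeResolvent κ (a + 1) (Z.indicator 1) x ≠ 0) :
    ∃ (g : α → ℝ≥0∞) (ν : Measure α), Measurable g ∧ IsFiniteMeasure ν ∧ m ≪ ν ∧
      (∀ x, timeResolvent κ (a + 1) g x ≠ 0) ∧ (∀ x, timeResolvent κ (a + 1) g x ≠ ∞) ∧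
      ∀ f : α → ℝ≥0∞, Measurable f → ∀ x,
        timeResolvent κ (a + 1) g x * ∫⁻ y, f y ∂ν ≤ timeResolvent κ a f x := by
  obtain ⟨U, hU1, hU⟩ := hκ.exists_resolvent_kernel (β := a + 1) (by linarith)
  have : IsFiniteKernel U := ⟨1, ENNReal.one_lt_top, hU1⟩
  have hUZ : ∀ Z, MeasurableSet Z → ∀ x, U x Z = timeResolvent κ (a + 1) (Z.indicator 1) x := by
    intro Z hZ x
    rw [← hU _ (measurable_one.indicator hZ) x, lintegral_indicator_one hZ]
  have hmU : ∀ x, m ≪ U x := fun x => Measure.AbsolutelyContinuous.mk fun Z hZ h0 => by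
    by_contra hne
    exact hm Z hZ hne x ((hUZ Z hZ x).symm.trans h0)
  obtain ⟨B, C, c, hB, hC, hmB, hmC, hc, hmin⟩ :=
    exists_minorization_of_absolutelyContinuous U m hmU
  let g : α → ℝ≥0∞ := fun x => c * B.indicator 1 x
  have hg : Measurable g := (measurable_one.indicator hB).const_mul _
  have hgU : ∀ x, timeResolvent κ (a + 1) g x = c * U x B := fun x => by
    rw [← hU g hg x, lintegral_const_mul _ (measurable_one.indicator hB),
      lintegral_indicator_one hB]
  let ν : Measure α := (m.restrict C).bind U
  have hν : ∀ f : α → ℝ≥0∞, Measurable f → ∫⁻ y, f y ∂ν = ∫⁻ z in C, ∫⁻ y, f y ∂(U z) ∂m :=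
    fun f hf => Measure.lintegral_bind U.measurable.aemeasurable hf.aemeasurable
  refine ⟨g, ν, hg, ⟨?_⟩, Measure.AbsolutelyContinuous.mk fun Z hZ h0 => ?_, fun x => ?_,
    fun x => ?_, fun f hf x => ?_⟩
  · rw [Measure.bind_apply MeasurableSet.univ U.measurable.aemeasurable]
    refine (lintegral_mono hU1).trans_lt ?_
    simp
  · rw [Measure.bind_apply hZ U.measurable.aemeasurable,
      lintegral_eq_zero_iff (U.measurable_coe hZ)] at h0
    have : (ae (m.restrict C)).NeBot := by
      rwa [ae_neBot, Ne, Measure.restrict_eq_zero]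
    obtain ⟨z, hz⟩ := h0.exists
    exact hmU z hz
  · rw [hgU]
    exact mul_ne_zero (by exact_mod_cast hc.ne') fun h => hmB (hmU x h)
  · rw [hgU]
    exact ENNReal.mul_ne_top ENNReal.coe_ne_top (measure_ne_top _ _)
  · have hdecr : ∀ h : α → ℝ≥0∞, Measurable h → (∀ y, h y ≤ timeResolvent κ a f y) →
        ∀ y, ∫⁻ z, h z ∂(U y) ≤ timeResolvent κ a f y := fun h hh hle y => by
      rw [hU h hh]
      exact (timeResolvent_mono le_rfl hle y).trans (hκ.timeResolvent_timeResolvent_le hf a y)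
    have h1 : ∀ y, ∫⁻ z, f z ∂(U y) ≤ timeResolvent κ a f y := fun y => by
      rw [hU f hf]
      exact timeResolvent_mono (by linarith) (fun _ => le_rfl) y
    have m1 : Measurable fun y => ∫⁻ z, f z ∂(U y) := hf.lintegral_kernel
    have m2 : Measurable fun y => ∫⁻ z, ∫⁻ w, f w ∂(U z) ∂(U y) := m1.lintegral_kernel
    have m3 : Measurable fun y => ∫⁻ z, ∫⁻ w, ∫⁻ v, f v ∂(U w) ∂(U z) ∂(U y) :=
      m2.lintegral_kernel
    calc timeResolvent κ (a + 1) g x * ∫⁻ y, f y ∂ν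
        = ∫⁻ _ in B, c * ∫⁻ z in C, ∫⁻ y, f y ∂(U z) ∂m ∂(U x) := by
          rw [hgU, hν f hf, setLIntegral_const]
          ring
      _ ≤ ∫⁻ y in B, ∫⁻ z, ∫⁻ w, ∫⁻ v, f v ∂(U w) ∂(U z) ∂(U y) ∂(U x) :=
          setLIntegral_mono' hB fun y hy => hmin y hy _ m1
      _ ≤ ∫⁻ y, ∫⁻ z, ∫⁻ w, ∫⁻ v, f v ∂(U w) ∂(U z) ∂(U y) ∂(U x) :=
          setLIntegral_le_lintegral _ _
      _ ≤ timeResolvent κ a f x := hdecr _ m3 (hdecr _ m2 (hdecr _ m1 h1)) x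

theorem isSubMarkovSemigroup_killedKernel {d : ℕ} {A : LevyOperator d}
    {P : Rd d → Measure (PathSpace d)} {D : Set (Rd d)} (hD : IsOpen D)
    (hP : IsStrongMarkovSolution A P) : IsSubMarkovSemigroup (killedKernel hD hP) where
  apply_univ_le p := by
    have := (hP.solution p.2).isProbabilityMeasure
    exact (killedMeasure_apply hD p.1 p.2 MeasurableSet.univ).trans_le prob_le_one
  apply_add s t x _ hZ := killedMeasure_add hD hP s t x hZ

theorem killedResolvent_eq {d : ℕ} {A : LevyOperator d} {P : Rd d → Measure (PathSpace d)}
    {D : Set (Rd d)} (hD : IsOpen D) (hA : A.Admissible D) (hP : IsStrongMarkovSolution A P)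
    (a : ℝ) {f : D → ℝ≥0} (hf : Measurable f) (x : D) :
    killedResolvent P D a f x = timeResolvent (killedKernel hD hP) a (fun y => f y) x :=
  lintegral_congr fun t => by
    rw [killedSemigroup_eq hD hA hP _ hf]
    rfl

theorem theorem3p3 {d : ℕ} (D : Set (Rd d)) (hDo : IsOpen D) (hDc : IsConnected D)
    (A : LevyOperator d) (hA : A.Admissible D)
    (P : Rd d → Measure (PathSpace d)) (hP : IsStrongMarkovSolution A P)
    (hET : ExitsFinitely P D)
    (m : Measure D) (hmσ : SigmaFinite m) (hm0 : m ≠ 0)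
    (hIR : IsResolventIrreducible P D m)
    (α : ℝ) (hα : 0 ≤ α) :
    ∃ (ψ : D → ℝ≥0) (ν : Measure D),
      (∀ x, 0 < ψ x) ∧ IsExcessive P D (α + 1) ψ ∧ m ≪ ν ∧ Minorization P D α ψ ν := by
  have hκ := isSubMarkovSemigroup_killedKernel hDo hP
  have : NeZero m := ⟨hm0⟩
  have hirr : ∀ Z : Set D, MeasurableSet Z → m.toFinite Z ≠ 0 → ∀ x,
      timeResolvent (killedKernel hDo hP) (α + 1) (Z.indicator 1) x ≠ 0 := by
    intro Z hZ hmZ x h0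
    have hZm : Measurable (Z.indicator (1 : D → ℝ≥0)) := measurable_one.indicator hZ
    have hcoe : (fun y => ((Z.indicator (1 : D → ℝ≥0) y : ℝ≥0) : ℝ≥0∞)) = Z.indicator 1 := by
      ext y
      by_cases hy : y ∈ Z <;> simp [hy]
    have hpos := hIR (Z.indicator 1)
      ⟨hZm, 1, fun y => Set.indicator_le_self' (fun _ _ => zero_le) y⟩ ?_ x
    · rw [killedResolvent_eq hDo hA hP 1 hZm, hcoe] at hpos
      exact hpos.ne' (timeResolvent_eq_zero_of_eq_zero (measurable_one.indicator hZ) 1 h0)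
    · rw [hcoe, lintegral_indicator_one hZ, pos_iff_ne_zero]
      rwa [Ne, toFinite_apply_eq_zero_iff] at hmZ
  obtain ⟨g, ν, hg, hν, hmν, hpos, hfin, hmin⟩ := hκ.exists_minorization m.toFinite hα hirr
  set R := timeResolvent (killedKernel hDo hP) (α + 1) g
  have hRm : Measurable R := measurable_timeResolvent _ hg _
  have hcoe : ∀ x, ((R x).toNNReal : ℝ≥0∞) = R x := fun x => ENNReal.coe_toNNReal (hfin x)
  have hsemi : ∀ t x, killedSemigroup P D t (fun x => (R x).toNNReal) x
      = ∫⁻ y, R y ∂(killedKernel hDo hP (t, x)) := fun t x => by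
    rw [killedSemigroup_eq hDo hA hP t hRm.ennreal_toNNReal]
    simp only [hcoe]
    rfl
  refine ⟨fun x => (R x).toNNReal, ν, fun x => ENNReal.toNNReal_pos (hpos x) (hfin x),
    ⟨hRm.ennreal_toNNReal, fun t x => ?_, fun x => ?_⟩,
    (absolutelyContinuous_toFinite m).trans hmν, ⟨inferInstance, fun f hf x => ?_⟩⟩
  · rw [hsemi, hcoe]
    exact hκ.lintegral_timeResolvent_le hg _ t x
  · simp only [hsemi, hcoe]
    exact hκ.tendsto_lintegral_timeResolvent hg _ (hfin x)
  · rw [hcoe, killedResolvent_eq hDo hA hP α hf.1]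
    exact hmin _ hf.1.coe_nnreal_ennreal x
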